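/- Let $\mathbb{K}$ be an algebraically closed field of characteristic $0$, $n\ge 2$, and $\Bbbk$ any commutative ring. A \emph{commutative $\Bbbk$-superalgebra} is a unital associative $\mathbb{Z}/2$-graded $\Bbbk$-algebra $A=A_{\bar 0}\oplus A_{\bar 1}$ with $ab=(-1)^{|a||b|}ba$ for homogeneous $a,b$ and $a^2=0$ for $a\in A_{\bar 1}$; they form a category $\mathrm{salg}_\Bbbk$ with parity preserving $\Bbbk$-algebra homomorphisms as morphisms. Let $\Lambda(n)$ be the Grassmann algebra over $\mathbb{K}$ on odd generators $\xi_1,\dots,\xi_n$, and let $\mathfrak g=W(n)=\mathrm{Der}_{\mathbb K}(\Lambda(n))$ be the Lie superalgebra of its superderivations, with its defining representation $\Lambda(n)$. For $a\subseteq\{1,\dots,n\}$ let $\xi^a$ be the ordered monomial, and let $\partial_i$ be the superderivation with $\partial_i\xi_j=\delta_{ij}$. Take the Chevalley basis $\{\xi^a\partial_i\}$ of $W(n)$: its toral elements are $H_i=\xi_i\partial_i$, its root vectors are the $\xi^a\partial_i$ with $a\ne\{i\}$, and $\xi^a\partial_i$ has parity $|a|+1$. Let $M\subset\Lambda(n)$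 be the $\mathbb{Z}$-span of the monomials $\xi^a$. For $A\in\mathrm{salg}_\Bbbk$ put $V_A:=A\otimes_{\mathbb Z}M=A[\xi_1,\dots,\xi_n]$ (an $A$-superalgebra, with the usual sign rule, canonically $A\otimes_\Bbbk\Lambda_\Bbbk(n)$), and let $\mathrm{GL}(V_A)$ be the group of parity preserving $A$-linear automorphisms of $V_A$; by extension of scalars this is a group functor $\mathrm{GL}(V_\bullet)$ of $A$. Let $G_{\Lambda(n)}(A)\subseteq\mathrm{GL}(V_A)$ be the subgroup generated by - the elements $h_H(u)$, for $u\in U(A_{\bar 0})$ (the units of $A_{\bar 0}$) and $H=\sum_j z_jH_j$ with $z_j\in\mathbb{Z}$, where $h_H(u)$ acts as $u^{\mu(H)}$ on the vectors of weight $\mu$; and - the elements $\exp(tX)=\sum_{r\ge 0}t^r\,X^r/r!$, for $X$ a root vector of the Chevalley basis and $t\in A_{\bar 0}$ if $X$ is even, $t\in A_{\bar 1}$ if $X$ is odd. Let $\mathbf{G}_{\Lambda(n)}$ be the sheafification of the functor $A\mapsto G_{\Lambda(n)}(A)$, taken as a subgroup functor of the sheaf $\mathrm{GL}(V_\bullet)$,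 for the Zariski topology on $\mathrm{salg}_\Bbbk$, whose coverings are given by the localizations $A\to A_f$, $f\in s$, where $s\subseteq A_{\bar 0}$ generates the unit ideal of $A_{\bar 0}$. Let $\mathbf{Aut}(\Lambda(n))$ be the subgroup functor of $\mathrm{GL}(V_\bullet)$ whose value on $A$ is the group of all $A$-linear superalgebra automorphisms of $A[\xi_1,\dots,\xi_n]$. \textbf{Theorem.} $\mathbf{G}_{\Lambda(n)}=\mathbf{Aut}(\Lambda(n))$ as subgroup functors of $\mathrm{GL}(V_\bullet)$; that is, $\mathbf{G}_{\Lambda(n)}(A)$ equals the group of $A$-linear superalgebra automorphisms of $A[\xi_1,\dots,\xi_n]$ for every commutative $\Bbbk$-superalgebra $A$. -/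

import Mathlib

open CategoryTheory TensorProduct

universe u v w

noncomputable section

/-- A commutative superalgebra over `k`: a unital associative `k`-algebra with a `ℤ/2`-grading
whose homogeneous elements supercommute and whose odd elements have square zero. -/
structure CommSuperAlg (k : Type u) [CommRing k] : Type (max u (v + 1)) where
  carrier : Type v
  [ring : Ring carrier]
  [algebra : Algebra k carrier]
  grading : ZMod 2 → Submodule k carrier
  [graded : GradedAlgebra grading]
  super_comm : ∀ (i j : ZMod 2) (a b : carrier), a ∈ grading i → b ∈ grading j →
    a * b = (-1) ^ (i.val * j.val) * (b * a)
  odd_sq : ∀ a : carrier, a ∈ grading 1 → a * a = 0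

namespace CommSuperAlg

variable {k : Type u} [CommRing k]

instance : CoeSort (CommSuperAlg.{u, v} k) (Type v) := ⟨carrier⟩
attribute [instance] ring algebra graded

instance : Category (CommSuperAlg.{u, v} k) where
  Hom A B := A.grading →ₐᵍ[k] B.grading
  id A := GradedAlgHom.id k A.grading
  comp f g := GradedAlgHom.comp g f

/-- The underlying algebra homomorphism of a morphism. -/
def homAlg {A B : CommSuperAlg.{u, v} k} (f : A ⟶ B) : A →ₐ[k] B := GradedAlgHom.toAlgHom f

theorem homAlg_mem {A B : CommSuperAlg.{u, v} k} (f : A ⟶ B) {i : ZMod 2} {a : A}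
    (ha : a ∈ A.grading i) : homAlg f a ∈ B.grading i := GradedAlgHom.map_mem f ha

@[simp] theorem homAlg_id (A : CommSuperAlg.{u, v} k) : homAlg (𝟙 A) = AlgHom.id k A := rfl
@[simp] theorem homAlg_comp {A B C : CommSuperAlg.{u, v} k} (f : A ⟶ B) (g : B ⟶ C) :
    homAlg (f ≫ g) = (homAlg g).comp (homAlg f) := rfl

theorem hom_ext {A B : CommSuperAlg.{u, v} k} {f g : A ⟶ B} (h : ∀ a, homAlg f a = homAlg g a) :
    f = g := GradedAlgHom.coe_toAlgHom_injective (AlgHom.ext h)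

/-- Build a morphism from a grading preserving algebra homomorphism. -/
def mkHom {A B : CommSuperAlg.{u, v} k} (f : A →ₐ[k] B)
    (h : ∀ (i : ZMod 2) (a : A), a ∈ A.grading i → f a ∈ B.grading i) : A ⟶ B :=
  ({ f with map_mem := fun {i a} ha => h i a ha } : A.grading →ₐᵍ[k] B.grading)

@[simp] theorem homAlg_mkHom {A B : CommSuperAlg.{u, v} k} (f : A →ₐ[k] B)
    (h : ∀ (i : ZMod 2) (a : A), a ∈ A.grading i → f a ∈ B.grading i) :
    homAlg (mkHom f h) = f := rfl

theorem _root_.univ_zmod_two : (Set.univ : Set (ZMod 2)) = {0, 1} := by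
  have h : ∀ i : ZMod 2, i = 0 ∨ i = 1 := by decide
  exact (Set.eq_univ_of_forall fun i => by simpa using h i).symm

/-- A pair of complementary even and odd parts is a grading. -/
theorem _root_.isInternal_of_isCompl {R A : Type*} [CommRing R] [Ring A] [Algebra R A]
    (𝒜 : ZMod 2 → Submodule R A) (h : IsCompl (𝒜 0) (𝒜 1)) :
    DirectSum.IsInternal 𝒜 :=
  (DirectSum.isInternal_submodule_iff_isCompl 𝒜 (i := 0) (j := 1) (by decide)
    univ_zmod_two).2 h

theorem _root_.isCompl_even_odd {R A : Type*} [CommRing R] [Ring A] [Algebra R A]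
    (𝒜 : ZMod 2 → Submodule R A) [GradedAlgebra 𝒜] : IsCompl (𝒜 0) (𝒜 1) :=
  (DirectSum.isInternal_submodule_iff_isCompl 𝒜 (i := 0) (j := 1) (by decide)
    univ_zmod_two).1 (DirectSum.Decomposition.isInternal 𝒜)

theorem _root_.exists_even_add_odd {R A : Type*} [CommRing R] [Ring A] [Algebra R A]
    (𝒜 : ZMod 2 → Submodule R A) [GradedAlgebra 𝒜] (a : A) :
    ∃ x ∈ 𝒜 0, ∃ y ∈ 𝒜 1, a = x + y := by
  have h : a ∈ 𝒜 0 ⊔ 𝒜 1 := by rw [(isCompl_even_odd 𝒜).sup_eq_top]; trivial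
  obtain ⟨x, hx, y, hy, h⟩ := Submodule.mem_sup.1 h
  exact ⟨x, hx, y, hy, h.symm⟩

/-- The even part `A₀`, a subalgebra. -/
abbrev even (A : CommSuperAlg.{u, v} k) : Subalgebra k A := SetLike.GradeZero.subalgebra A.grading

theorem even_commute (A : CommSuperAlg.{u, v} k) {a : A} (ha : a ∈ A.grading 0) (b : A) :
    a * b = b * a := by
  obtain ⟨x, hx, y, hy, rfl⟩ := exists_even_add_odd A.grading b
  have h1 := A.super_comm 0 0 a x ha hx
  have h2 := A.super_comm 0 1 a y ha hy
  simp only [ZMod.val_zero, zero_mul, pow_zero, one_mul] at h1 h2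
  rw [mul_add, add_mul, h1, h2]

instance (A : CommSuperAlg.{u, v} k) : CommRing A.even :=
  { (inferInstance : Ring A.even) with
    mul_comm := fun a b => Subtype.ext (A.even_commute a.2 b) }

instance (A : CommSuperAlg.{u, v} k) : Algebra A.even A where
  algebraMap := (A.even.val : A.even →+* A)
  commutes' a b := A.even_commute a.2 b
  smul_def' _ _ := rfl

/-! ### Localization at an even element -/

/-- The ring underlying `A_f`, for `f` even: the localization of the `A₀`-algebra `A`. -/
def Loc (A : CommSuperAlg.{u, v} k) (f : A.even) : Type v :=
  LocalizedModule (Submonoid.powers f) A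

namespace Loc
variable (A : CommSuperAlg.{u, v} k) (f : A.even)

instance : Ring (Loc A f) := inferInstanceAs (Ring (LocalizedModule (Submonoid.powers f) A))
instance : Algebra A.even (Loc A f) :=
  inferInstanceAs (Algebra A.even (LocalizedModule (Submonoid.powers f) A))
instance : Algebra k (Loc A f) := Algebra.compHom _ (algebraMap k A.even)

variable {A f}
/-- The fraction `a / f ^ m`. -/
def mk (a : A) (m : ℕ) : Loc A f := LocalizedModule.mk a ⟨f ^ m, m, rfl⟩

theorem mk_surj (x : Loc A f) : ∃ a m, x = mk a m := by
  induction x using LocalizedModule.induction_on with | _ a s => 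
  obtain ⟨_, m, rfl⟩ := s
  exact ⟨a, m, rfl⟩

theorem mk_eq {a b : A} {m l : ℕ} : (mk a m : Loc A f) = mk b l ↔
    ∃ c : ℕ, (f : A) ^ c * ((f : A) ^ l * a) = (f : A) ^ c * ((f : A) ^ m * b) := by
  refine LocalizedModule.mk_eq.trans ⟨?_, ?_⟩
  · rintro ⟨⟨_, c, rfl⟩, h⟩; exact ⟨c, h⟩
  · rintro ⟨c, h⟩; exact ⟨⟨_, c, rfl⟩, h⟩

theorem mk_mul (a b : A) (m l : ℕ) : (mk a m * mk b l : Loc A f) = mk (a * b) (m + l) := by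
  refine LocalizedModule.mk_mul_mk.trans ?_
  unfold mk; congr 1; exact Subtype.ext (pow_add f m l).symm

theorem mk_add (a b : A) (m l : ℕ) :
    (mk a m + mk b l : Loc A f) = mk ((f : A) ^ l * a + (f : A) ^ m * b) (m + l) := by
  refine LocalizedModule.mk_add_mk.trans ?_
  unfold mk; congr 1; exact Subtype.ext (pow_add f m l).symm

theorem one_eq : (1 : Loc A f) = mk 1 0 := by
  refine OreLocalization.one_def.trans ?_
  unfold mk; congr 1; exact Subtype.ext (by simp)

theorem zero_eq (m : ℕ) : (0 : Loc A f) = mk 0 m := (LocalizedModule.zero_mk _).symm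

theorem algebraMap_eq (r : k) : algebraMap k (Loc A f) r = mk (algebraMap k A r) 0 := by
  show LocalizedModule.mk _ _ = _
  unfold mk; congr 1; exact Subtype.ext (by simp)

theorem smul_mk (r : k) (a : A) (m : ℕ) : (r • mk a m : Loc A f) = mk (r • a) m := by
  rw [Algebra.smul_def, algebraMap_eq, mk_mul, zero_add, Algebra.smul_def]

theorem neg_mk (a : A) (m : ℕ) : (-mk a m : Loc A f) = mk (-a) m := by
  rw [← neg_one_smul k, smul_mk, neg_one_smul]

theorem mk_scale (a : A) (m l : ℕ) : (mk ((f : A) ^ l * a) (m + l) : Loc A f) = mk a m :=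
  mk_eq.2 ⟨0, by rw [← mul_assoc ((f:A)^m), pow_add]⟩

theorem mk_add_same (a b : A) (m : ℕ) : (mk a m + mk b m : Loc A f) = mk (a + b) m := by
  rw [mk_add, ← mul_add, mk_scale]

theorem pow_mul_mem (A : CommSuperAlg.{u, v} k) (f : A.even) (l : ℕ) {i : ZMod 2} {a : A}
    (ha : a ∈ A.grading i) : (f : A) ^ l * a ∈ A.grading i := by
  have := SetLike.mul_mem_graded (SetLike.pow_mem_graded l f.2) ha
  simpa using this

/-- The homogeneous parts of `A_f`: fractions with homogeneous numerator. -/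
def grading (A : CommSuperAlg.{u, v} k) (f : A.even) (i : ZMod 2) : Submodule k (Loc A f) where
  carrier := {x | ∃ a ∈ A.grading i, ∃ m, x = mk a m}
  zero_mem' := ⟨0, zero_mem _, 0, zero_eq 0⟩
  add_mem' := by
    rintro _ _ ⟨a, ha, m, rfl⟩ ⟨b, hb, l, rfl⟩
    exact ⟨_, add_mem (pow_mul_mem A f l ha) (pow_mul_mem A f m hb), _, mk_add ..⟩
  smul_mem' := by
    rintro r _ ⟨a, ha, m, rfl⟩
    exact ⟨_, Submodule.smul_mem _ r ha, m, smul_mk ..⟩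

theorem isCompl (A : CommSuperAlg.{u, v} k) (f : A.even) :
    IsCompl (grading A f 0) (grading A f 1) := by
  constructor
  · rw [Submodule.disjoint_def]
    rintro _ ⟨a, ha, m, rfl⟩ ⟨b, hb, l, hab⟩
    obtain ⟨c, hc⟩ := mk_eq.1 hab
    have h0 : (f : A) ^ c * ((f : A) ^ l * a) = 0 := by
      refine (Submodule.disjoint_def.1 (isCompl_even_odd A.grading).disjoint) _
        (pow_mul_mem A f c (pow_mul_mem A f l ha)) ?_
      rw [hc]
      exact pow_mul_mem A f c (pow_mul_mem A f m hb)
    rw [zero_eq 0]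
    refine mk_eq.2 ⟨c + l, ?_⟩
    rw [pow_add, pow_zero, one_mul, mul_assoc, h0]; simp
  · rw [codisjoint_iff_le_sup]
    intro x _
    obtain ⟨a, m, rfl⟩ := mk_surj x
    obtain ⟨y, hy, z, hz, rfl⟩ := exists_even_add_odd A.grading a
    rw [← mk_add_same]
    exact Submodule.add_mem_sup ⟨y, hy, m, rfl⟩ ⟨z, hz, m, rfl⟩

instance (A : CommSuperAlg.{u, v} k) (f : A.even) : SetLike.GradedMonoid (grading A f) where
  one_mem := ⟨1, SetLike.one_mem_graded _, 0, one_eq⟩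
  mul_mem := by
    rintro i j _ _ ⟨a, ha, m, rfl⟩ ⟨b, hb, l, rfl⟩
    exact ⟨_, SetLike.mul_mem_graded ha hb, _, mk_mul ..⟩

instance (A : CommSuperAlg.{u, v} k) (f : A.even) : GradedAlgebra (grading A f) where
  toDecomposition := (isInternal_of_isCompl _ (isCompl A f)).chooseDecomposition

end Loc

/-- The commutative superalgebra `A_f`. -/
def loc (A : CommSuperAlg.{u, v} k) (f : A.even) : CommSuperAlg.{u, v} k where
  carrier := Loc A f
  grading := Loc.grading A f
  super_comm := by
    rintro i j _ _ ⟨a, ha, m, rfl⟩ ⟨b, hb, l, rfl⟩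
    rw [Loc.mk_mul, Loc.mk_mul, A.super_comm i j a b ha hb, add_comm m l]
    rcases Nat.even_or_odd (i.val * j.val) with h | h
    · rw [h.neg_one_pow, h.neg_one_pow, one_mul, one_mul]
    · rw [h.neg_one_pow, h.neg_one_pow, neg_one_mul, neg_one_mul, Loc.neg_mk]
  odd_sq := by
    rintro _ ⟨a, ha, m, rfl⟩
    rw [Loc.mk_mul, A.odd_sq a ha, ← Loc.zero_eq]

/-- The canonical morphism `A ⟶ A_f`. -/
def toLoc (A : CommSuperAlg.{u, v} k) (f : A.even) : A ⟶ A.loc f :=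
  mkHom (B := A.loc f)
    { toFun := fun a => (Loc.mk a 0 : Loc A f)
      map_one' := Loc.one_eq.symm
      map_mul' := fun a b => (Loc.mk_mul a b 0 0).symm
      map_zero' := (Loc.zero_eq 0).symm
      map_add' := fun a b => (Loc.mk_add_same a b 0).symm
      commutes' := fun r => (Loc.algebraMap_eq r).symm }
    (fun _ a ha => ⟨a, ha, 0, rfl⟩)

theorem toLoc_apply (A : CommSuperAlg.{u, v} k) (f : A.even) (a : A) :
    homAlg (A.toLoc f) a = (Loc.mk a 0 : Loc A f) := rfl

end CommSuperAlg

namespace CommSuperAlg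
variable {k : Type u} [CommRing k]

/-- The universal property of `A ⟶ A_f`: a morphism under which `f` becomes a unit factors. -/
theorem exists_locLift {A B : CommSuperAlg.{u, v} k} (f : A.even) (φ : A ⟶ B) (g : B)
    (hg : g ∈ B.grading 0) (hfg : homAlg φ f * g = 1) : ∃ ψ : A.loc f ⟶ B, A.toLoc f ≫ ψ = φ := by
  have hc : ∀ b : B, b * g = g * b := fun b => (B.even_commute hg b).symm
  have hpow : ∀ m : ℕ, homAlg φ f ^ m * g ^ m = 1 := fun m => by
    have hcm : Commute (homAlg φ (f : A)) g := hc _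
    rw [← hcm.mul_pow, hfg, one_pow]
  have hcp : ∀ (b : B) (m : ℕ), b * g ^ m = g ^ m * b := fun b m =>
    ((show Commute b g from hc b).pow_right m)
  have key : ∀ (a b : A) (m l : ℕ), (Loc.mk a m : Loc A f) = Loc.mk b l →
      homAlg φ a * g ^ m = homAlg φ b * g ^ l := by
    intro a b m l h
    obtain ⟨c, h⟩ := Loc.mk_eq.1 h
    have h := congrArg (homAlg φ) h
    simp only [map_mul, map_pow] at h
    have e : ∀ (x : B) (p q : ℕ), g ^ (c + p + q) * (homAlg φ f ^ c * (homAlg φ f ^ q * x))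
        = x * g ^ p := by
      intro x p q
      have h1 : g ^ q * (homAlg φ f ^ q * x) = x := by
        rw [← mul_assoc, ← hcp, hpow, one_mul]
      have h2 : ∀ y, g ^ c * (homAlg φ f ^ c * y) = y := fun y => by
        rw [← mul_assoc, ← hcp, hpow, one_mul]
      rw [show c + p + q = p + (q + c) by omega, pow_add, pow_add, mul_assoc, mul_assoc, h2, h1,
        hcp]
    rw [← e _ m l, h, ← e _ l m, add_right_comm]
  choose num den hnd using fun x : Loc A f => Loc.mk_surj x
  have val : ∀ a m, homAlg φ (num (Loc.mk a m : Loc A f)) * g ^ den (Loc.mk a m : Loc A f)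
      = homAlg φ a * g ^ m := fun a m => key _ _ _ _ (hnd _).symm
  let ψ : Loc A f →ₐ[k] B :=
    { toFun := fun x : Loc A f => homAlg φ (num x) * g ^ den x
      map_one' := by rw [Loc.one_eq, val]; simp
      map_mul' := by
        intro x y
        obtain ⟨a, m, rfl⟩ := Loc.mk_surj x
        obtain ⟨b, l, rfl⟩ := Loc.mk_surj y
        rw [Loc.mk_mul, val, val, val, map_mul, pow_add]
        rw [((Commute.refl g).pow_pow m l).eq]
        simp only [mul_assoc]
        rw [← hcp (homAlg φ b * g ^ l) m, mul_assoc]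
      map_zero' := by rw [Loc.zero_eq 0, val]; simp
      map_add' := by
        intro x y
        obtain ⟨a, m, rfl⟩ := Loc.mk_surj x
        obtain ⟨b, l, rfl⟩ := Loc.mk_surj y
        rw [← Loc.mk_scale a m l, ← Loc.mk_scale b l m, add_comm l m, Loc.mk_add_same, val, val,
          val, map_add, add_mul]
      commutes' := by intro r; rw [Loc.algebraMap_eq, val]; simp }
  have hψ : ∀ a m, ψ (Loc.mk a m) = homAlg φ a * g ^ m := val
  refine ⟨mkHom (A := A.loc f) ψ ?_, hom_ext fun a => ?_⟩
  · rintro i _ ⟨a, ha, m, rfl⟩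
    have h : homAlg φ a * g ^ m ∈ B.grading i := by
      simpa using SetLike.mul_mem_graded (homAlg_mem φ ha) (SetLike.pow_mem_graded m hg)
    rw [← hψ] at h
    exact h
  · exact (hψ a 0).trans (by simp)

/-- The ring homomorphism `A₀ → B₀` induced by a morphism. -/
def mapEven {A B : CommSuperAlg.{u, v} k} (φ : A ⟶ B) : A.even →+* B.even where
  toFun a := ⟨homAlg φ a, homAlg_mem φ a.2⟩
  map_one' := Subtype.ext (by simp)
  map_mul' _ _ := Subtype.ext (by simp)
  map_zero' := Subtype.ext (by simp)
  map_add' _ _ := Subtype.ext (by simp)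

/-- If `φ f` divides `g` in `B₀`, then `A ⟶ B ⟶ B_g` factors through `A_f`. -/
theorem exists_locLift_of_dvd {A B : CommSuperAlg.{u, v} k} (f : A.even) (φ : A ⟶ B)
    (c g : B.even) (hg : g = mapEven φ f * c) : ∃ ψ : A.loc f ⟶ B.loc g,
      A.toLoc f ≫ ψ = φ ≫ B.toLoc g := by
  refine exists_locLift f _ (Loc.mk (c : B) 1 : Loc B g) ⟨c, c.2, 1, rfl⟩ ?_
  have h : (Loc.mk (homAlg φ f) 0 * Loc.mk (c : B) 1 : Loc B g) = 1 := by
    rw [Loc.mk_mul, Loc.one_eq]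
    refine Loc.mk_eq.2 ⟨0, ?_⟩
    simp [mapEven, hg]
  exact h

/-- The composite `A ⟶ A_f ⟶ (A_f)_h` with `h = a / f ^ m` can be continued to
`A ⟶ A_{f a}`. -/
theorem exists_loc_loc (A : CommSuperAlg.{u, v} k) (f a : A.even) (m : ℕ) (h : (A.loc f).even)
    (hh : (h : A.loc f) = (Loc.mk (a : A) m : Loc A f)) :
    ∃ ψ : (A.loc f).loc h ⟶ A.loc (a * f), A.toLoc f ≫ (A.loc f).toLoc h ≫ ψ = A.toLoc (a * f) := by
  obtain ⟨ψ₁, h₁⟩ := exists_locLift_of_dvd f (𝟙 A) a (a * f) (mul_comm _ _)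
  have e : ∀ b : A, homAlg ψ₁ (Loc.mk b 0 : Loc A f) = (Loc.mk b 0 : Loc A (a * f)) := fun b =>
    congrArg (fun χ => homAlg χ b) h₁
  have hfm : ((f : A) ^ m) ∈ A.grading 0 := by simpa using SetLike.pow_mem_graded m (show (f : A) ∈ A.grading 0 from f.2)
  obtain ⟨ψ₂, h₂⟩ := exists_locLift h ψ₁
    (Loc.mk ((f : A) ^ m) 0 * Loc.mk (f : A) 1 : Loc A (a * f))
    (by
      rw [Loc.mk_mul]
      refine ⟨_, ?_, _, rfl⟩
      simpa using SetLike.mul_mem_graded hfm (show (f : A) ∈ A.grading 0 from f.2)) (by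
      have e1 : (Loc.mk (a : A) m * Loc.mk ((f : A) ^ m) 0 : Loc A f) = Loc.mk a 0 := by
        rw [Loc.mk_mul, ← Loc.mk_scale (a : A) 0 m, zero_add, add_zero,
          A.even_commute a.2]
      have e2 := (map_mul (homAlg ψ₁) (Loc.mk (a : A) m : Loc A f) (Loc.mk ((f : A) ^ m) 0 : Loc A f))
      have e3 := (congrArg (homAlg ψ₁) e1).symm.trans e2
      have e3 := (e a).symm.trans (e3.trans (congrArg (fun y => homAlg ψ₁ (Loc.mk (a : A) m : Loc A f) * y)
        (e ((f : A) ^ m))))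
      rw [hh]
      have e4 : (Loc.mk (a : A) 0 * Loc.mk (f : A) 1 : Loc A (a * f)) = 1 := by
        rw [Loc.mk_mul, Loc.one_eq]
        refine Loc.mk_eq.2 ⟨0, ?_⟩
        simp
      refine Eq.trans ?_ e4
      refine (mul_assoc _ _ _).symm.trans ?_
      exact congrArg (fun x : Loc A (a * f) => x * Loc.mk (f : A) 1) e3.symm)
  exact ⟨ψ₂, by rw [h₂, h₁, Category.id_comp]⟩

theorem mem_radical_of_span_loc (A : CommSuperAlg.{u, v} k) (f : A.even) (I : Ideal A.even)
    (t : Set (A.loc f).even) (ht : Ideal.span t = ⊤)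
    (hI : ∀ h ∈ t, ∀ (a : A.even) (m : ℕ), (h : A.loc f) = (Loc.mk (a : A) m : Loc A f) →
      a * f ∈ I) : f ∈ I.radical := by
  have key : ∀ h ∈ Ideal.span t, ∃ a : A.even, ∃ m : ℕ,
      ((h : A.loc f) = (Loc.mk (a : A) m : Loc A f)) ∧ a * f ∈ I := by
    intro h hh
    refine Submodule.span_induction ?_ ⟨0, 0, Loc.zero_eq 0, by simp⟩ ?_ ?_ hh
    · rintro ⟨_, a, ha, m, rfl⟩ hx
      exact ⟨⟨a, ha⟩, m, rfl, hI _ hx ⟨a, ha⟩ m rfl⟩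
    · rintro ⟨x, _⟩ ⟨y, _⟩ _ _ ⟨a, m, hx, ha⟩ ⟨b, l, hy, hb⟩
      refine ⟨f ^ l * a + f ^ m * b, m + l, ?_, ?_⟩
      · have h := Loc.mk_add (f := f) (a : A) b m l
        dsimp only at hx hy
        subst hx hy
        exact h
      · rw [add_mul, mul_assoc, mul_assoc]
        exact add_mem (I.mul_mem_left _ ha) (I.mul_mem_left _ hb)
    · rintro ⟨_, b, hb, l, rfl⟩ ⟨x, _⟩ _ ⟨a, m, hx, ha⟩
      refine ⟨⟨b, hb⟩ * a, l + m, ?_, ?_⟩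
      · have h := Loc.mk_mul (f := f) b (a : A) l m
        dsimp only at hx
        subst hx
        exact h
      · rw [mul_assoc]; exact I.mul_mem_left _ ha
  obtain ⟨a, m, h1, ha⟩ := key 1 (by rw [ht]; trivial)
  have h1 : (1 : Loc A f) = Loc.mk (a : A) m := h1
  rw [Loc.one_eq] at h1
  obtain ⟨c, hc⟩ := Loc.mk_eq.1 h1
  refine ⟨c + m + 1, ?_⟩
  have : f ^ (c + m + 1) = f ^ c * (a * f) := Subtype.ext (by
    simp only [pow_zero, mul_one, one_mul] at hc
    simp only [pow_add, pow_one]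
    push_cast
    rw [hc, mul_assoc])
  rw [this]
  exact I.mul_mem_left _ ha

end CommSuperAlg

open CommSuperAlg Opposite

/-- The Zariski topology on `(salg_k)ᵒᵖ`: the coverings of `A` are generated by the families
`A ⟶ A_f`, `f ∈ s`, where `s ⊆ A₀` generates the unit ideal of `A₀`. -/
def zariski (k : Type u) [CommRing k] : GrothendieckTopology (CommSuperAlg.{u, v} k)ᵒᵖ where
  sieves X := {S | ∃ s : Set X.unop.even, Ideal.span s = ⊤ ∧
    ∀ f ∈ s, S.arrows (X.unop.toLoc f).op}
  top_mem' X := ⟨{1}, Ideal.span_singleton_one, fun _ _ => trivial⟩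
  pullback_stable' := by
    rintro X Y S φ ⟨s, hs, hS⟩
    refine ⟨mapEven φ.unop '' s, ?_, ?_⟩
    · rw [← Ideal.map_span, hs, Ideal.map_top]
    · rintro _ ⟨f, hf, rfl⟩
      obtain ⟨ψ, hψ⟩ := exists_locLift_of_dvd f φ.unop 1 _ (mul_one _).symm
      show S.arrows ((Y.unop.toLoc (mapEven φ.unop f)).op ≫ φ)
      have : (Y.unop.toLoc (mapEven φ.unop f)).op ≫ φ = ψ.op ≫ (X.unop.toLoc f).op :=
        congrArg Quiver.Hom.op hψ.symm
      rw [this]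
      exact S.downward_closed (hS f hf) _
  transitive' := by
    rintro X S ⟨s, hs, hS⟩ R hR
    refine ⟨{g | R.arrows (X.unop.toLoc g).op}, ?_, fun f hf => hf⟩
    have h2 : Ideal.span s ≤ (Ideal.span {g | R.arrows (X.unop.toLoc g).op}).radical := by
      refine Ideal.span_le.2 fun f hf => ?_
      obtain ⟨t, ht, htR⟩ := hR (hS f hf)
      refine mem_radical_of_span_loc X.unop f _ t ht fun h hh a m e => Ideal.subset_span ?_
      obtain ⟨ψ, hψ⟩ := exists_loc_loc X.unop f a m h e
      show R.arrows (X.unop.toLoc (a * f)).op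
      rw [← hψ]
      exact R.downward_closed (htR h hh) ψ.op
    rwa [hs, top_le_iff, Ideal.radical_eq_top] at h2

/-- A subgroup functor of a group-valued functor. -/
@[ext]
structure SubgroupFunctor {C : Type*} [Category C] (F : C ⥤ GrpCat.{w}) where
  obj : ∀ X : C, Subgroup (F.obj X)
  map : ∀ {X Y : C} (φ : X ⟶ Y) (g : F.obj X), g ∈ obj X → (F.map φ).hom g ∈ obj Y

namespace SubgroupFunctor

variable {C : Type*} [Category C] {F : C ⥤ GrpCat.{w}}

/-- The underlying subfunctor of sets, as a presheaf on `Cᵒᵖ`. -/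
def toSubfunctor (G : SubgroupFunctor F) : Subfunctor (unopUnop C ⋙ F ⋙ forget GrpCat) where
  obj X := {g : F.obj X.unop.unop | g ∈ G.obj X.unop.unop}
  map φ g hg := G.map φ.unop.unop g hg

/-- The sheafification of a subgroup functor `G` of `F`, inside `F` (so that it is a sheaf
whenever `F` is): its points are the points of `F` that belong locally to `G`. -/
def sheafify (G : SubgroupFunctor F) (J : GrothendieckTopology Cᵒᵖ) : SubgroupFunctor F where
  obj X :=
    { carrier := {g | g ∈ (G.toSubfunctor.sheafify J).obj (op (op X))}
      one_mem' := G.toSubfunctor.le_sheafify J _ (one_mem (G.obj X))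
      mul_mem' := by
        intro a b ha hb
        refine J.superset_covering ?_ (J.intersection_covering ha hb)
        rintro Y f ⟨h1, h2⟩
        have h := mul_mem (S := Subgroup _) (s := G.obj Y.unop)
          (show (F.map f.unop).hom a ∈ _ from h1) (show (F.map f.unop).hom b ∈ _ from h2)
        rw [← map_mul] at h
        exact h
      inv_mem' := by
        intro a ha
        refine J.superset_covering ?_ ha
        rintro Y f h1
        have h := inv_mem (S := Subgroup _) (s := G.obj Y.unop)
          (show (F.map f.unop).hom a ∈ _ from h1)
        rw [← map_inv] at h
        exact h }
  map φ g hg := (G.toSubfunctor.sheafify J).map φ.op.op hg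

end SubgroupFunctor

/-! ### The Grassmann algebra and the Lie superalgebra `W(n)` -/

/-- The Grassmann algebra `Λ(n)` over `R` in the generators `ξ_i = ι (e_i)`. -/
abbrev Grassmann (R : Type w) [CommRing R] (n : ℕ) : Type w := ExteriorAlgebra R (Fin n → R)

namespace Grassmann

variable (R : Type w) [CommRing R] (n : ℕ)

/-- The parity grading of `Λ(n)`. -/
abbrev grading : ZMod 2 → Submodule R (Grassmann R n) :=
  CliffordAlgebra.evenOdd (0 : QuadraticForm R (Fin n → R))

/-- The monomials `ξ^a = ξ_{a₁} ⋯ ξ_{a_r}`, `a = {a₁ < ⋯ < a_r}`, form a basis of `Λ(n)`. -/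
def monomials : Module.Basis (Finset (Fin n)) R (Grassmann R n) :=
  (Pi.basisFun R (Fin n)).ExteriorAlgebra

/-- The left partial derivative `∂_i`, i.e. the superderivation with `∂_i ξ_j = δ_{ij}`. -/
def pderiv (i : Fin n) : Module.End R (Grassmann R n) :=
  CliffordAlgebra.contractLeft (LinearMap.proj i : Module.Dual R (Fin n → R))

variable {R n}

theorem monomials_mem_pow (a : Finset (Fin n)) :
    monomials R n a ∈ LinearMap.range (ExteriorAlgebra.ι R : (Fin n → R) →ₗ[R] _) ^ a.card := by
  have h := ExteriorAlgebra.basis_eq_coe_basis (Pi.basisFun R (Fin n)) (m := a.card) ⟨a, rfl⟩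
  rw [monomials, h]
  exact Subtype.prop _

theorem monomials_mem (a : Finset (Fin n)) : monomials R n a ∈ grading R n (a.card : ZMod 2) :=
  Submodule.mem_iSup_of_mem (⟨a.card, rfl⟩ : {m : ℕ // (m : ZMod 2) = (a.card : ZMod 2)})
    (monomials_mem_pow a)

theorem monomials_empty : monomials R n ∅ = 1 := by
  rw [monomials, ExteriorAlgebra.basis_apply]
  exact ExteriorAlgebra.ιMulti_zero_apply _

theorem monomials_mul (a b : Finset (Fin n)) :
    ∃ c : Finset (Fin n), ∃ z : ℤ, monomials R n a * monomials R n b = z • monomials R n c := by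
  by_cases h : Disjoint a b
  · exact ⟨_, _, ExteriorAlgebra.basis_mul_of_disjoint (Pi.basisFun R (Fin n))
      (m := a.card) (n := b.card) ⟨a, rfl⟩ ⟨b, rfl⟩ h⟩
  · exact ⟨∅, 0, (ExteriorAlgebra.basis_mul_of_not_disjoint (Pi.basisFun R (Fin n))
      (m := a.card) (n := b.card) ⟨a, rfl⟩ ⟨b, rfl⟩ h).trans (zero_smul _ _).symm⟩

/-- `D` is a superderivation of `Λ(n)` that is homogeneous of parity `p`. -/
structure IsSuperDerivation (p : ZMod 2) (D : Module.End R (Grassmann R n)) : Prop where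
  map_mem : ∀ (j : ZMod 2) (x : Grassmann R n), x ∈ grading R n j → D x ∈ grading R n (j + p)
  leibniz : ∀ (j : ZMod 2) (x y : Grassmann R n), x ∈ grading R n j →
    D (x * y) = D x * y + (-1) ^ (p.val * j.val) * (x * D y)

variable (R n) in
/-- The superderivations of parity `p`. -/
def superDer (p : ZMod 2) : Submodule R (Module.End R (Grassmann R n)) where
  carrier := {D | IsSuperDerivation p D}
  zero_mem' := ⟨fun _ _ _ => zero_mem _, fun _ _ _ _ => by simp⟩
  add_mem' hD hE := ⟨fun j x hx => add_mem (hD.map_mem j x hx) (hE.map_mem j x hx),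
    fun j x y hx => by
      simp only [LinearMap.add_apply, hD.leibniz j x y hx, hE.leibniz j x y hx, mul_add, add_mul]
      abel⟩
  smul_mem' r D hD := ⟨fun j x hx => Submodule.smul_mem _ r (hD.map_mem j x hx),
    fun j x y hx => by
      simp only [LinearMap.smul_apply, hD.leibniz j x y hx, smul_add, smul_mul_assoc,
        mul_smul_comm]⟩

variable (R n) in
/-- `W(n)`, the superspace of all superderivations of `Λ(n)`, inside `End(Λ(n))`. -/
def W : Submodule R (Module.End R (Grassmann R n)) := superDer R n 0 ⊔ superDer R n 1

theorem superDer_le_W (p : ZMod 2) : superDer R n p ≤ W R n := by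
  have h : ∀ p : ZMod 2, p = 0 ∨ p = 1 := by decide
  rcases h p with rfl | rfl
  · exact le_sup_left
  · exact le_sup_right

theorem pderiv_ι_mul (i : Fin n) (v : Fin n → R) (y : Grassmann R n) :
    pderiv R n i (CliffordAlgebra.ι 0 v * y) =
      v i • y - CliffordAlgebra.ι 0 v * pderiv R n i y :=
  CliffordAlgebra.contractLeft_ι_mul _ _ _

theorem pderiv_leibniz (i : Fin n) (x y : Grassmann R n) : pderiv R n i (x * y) =
    pderiv R n i x * y + CliffordAlgebra.involute x * pderiv R n i y := by
  induction x using CliffordAlgebra.induction generalizing y with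
  | algebraMap r =>
    rw [← Algebra.smul_def, map_smul, AlgHom.commutes, ← Algebra.smul_def,
      show pderiv R n i (algebraMap R _ r) = 0 from CliffordAlgebra.contractLeft_algebraMap _ _ _,
      zero_mul, zero_add]
  | ι v =>
    rw [pderiv_ι_mul, CliffordAlgebra.involute_ι,
      show pderiv R n i (CliffordAlgebra.ι 0 v) = algebraMap R _ (v i) from
        CliffordAlgebra.contractLeft_ι _ _ _, Algebra.smul_def, neg_mul, sub_eq_add_neg]
  | mul a b ha hb =>
    rw [mul_assoc, ha, hb, ha b, map_mul]
    simp only [mul_add, add_mul, mul_assoc, add_assoc]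
  | add a b ha hb =>
    rw [add_mul, map_add, ha, hb, map_add, map_add, add_mul, add_mul]
    abel

theorem involute_eq {j : ZMod 2} {x : Grassmann R n} (hx : x ∈ grading R n j) :
    CliffordAlgebra.involute x = (-1) ^ j.val * x := by
  have h : ∀ p : ZMod 2, p = 0 ∨ p = 1 := by decide
  rcases h j with rfl | rfl
  · rw [CliffordAlgebra.involute_eq_of_mem_even hx]; simp
  · rw [CliffordAlgebra.involute_eq_of_mem_odd hx]; simp [ZMod.val_one]

theorem pderiv_mem (i : Fin n) {j : ZMod 2} {x : Grassmann R n} (hx : x ∈ grading R n j) :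
    pderiv R n i x ∈ grading R n (j + 1) := by
  have two : (1 : ZMod 2) + 1 = 0 := by decide
  have hι : ∀ (v : Fin n → R) {j : ZMod 2} {x : Grassmann R n}, x ∈ grading R n (j + 1) →
      CliffordAlgebra.ι 0 v * x ∈ grading R n j := by
    intro v j x hx
    have := SetLike.mul_mem_graded (CliffordAlgebra.ι_mem_evenOdd_one 0 v) hx
    rwa [add_comm j, ← add_assoc, two, zero_add] at this
  have hι' : ∀ (v : Fin n → R) {j : ZMod 2} {x : Grassmann R n}, x ∈ grading R n j →
      CliffordAlgebra.ι 0 v * x ∈ grading R n (j + 1) := by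
    intro v j x hx
    rw [add_comm]
    exact SetLike.mul_mem_graded (CliffordAlgebra.ι_mem_evenOdd_one 0 v) hx
  induction x, hx using CliffordAlgebra.evenOdd_induction with
  | range_ι_pow v h =>
    have hz : ∀ p : ZMod 2, p = 0 ∨ p = 1 := by decide
    rcases hz j with rfl | rfl
    · rw [ZMod.val_zero, pow_zero] at h
      obtain ⟨r, rfl⟩ := Submodule.mem_one.1 h
      rw [show pderiv R n i (algebraMap R _ r) = 0 from CliffordAlgebra.contractLeft_algebraMap _ _ _]
      exact zero_mem _
    · rw [ZMod.val_one, pow_one] at h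
      obtain ⟨v, rfl⟩ := h
      rw [show pderiv R n i (CliffordAlgebra.ι 0 v) = algebraMap R _ (v i) from
        CliffordAlgebra.contractLeft_ι _ _ _, two]
      exact SetLike.algebraMap_mem_graded _ _
  | add x y hx hy h1 h2 => rw [map_add]; exact add_mem h1 h2
  | ι_mul_ι_mul v w x hx h =>
    rw [mul_assoc, pderiv_ι_mul, pderiv_ι_mul]
    refine sub_mem (Submodule.smul_mem _ _ (hι' w hx)) ?_
    refine hι' v (sub_mem (Submodule.smul_mem _ _ hx) (hι w h))

theorem ι_mul_eq (v : Fin n → R) (y : Grassmann R n) :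
    CliffordAlgebra.ι 0 v * y = CliffordAlgebra.involute y * CliffordAlgebra.ι 0 v := by
  induction y using CliffordAlgebra.induction with
  | algebraMap r => rw [AlgHom.commutes, Algebra.commutes]
  | ι w =>
    rw [CliffordAlgebra.involute_ι, neg_mul]
    exact eq_neg_of_add_eq_zero_left (ExteriorAlgebra.ι_add_mul_swap v w)
  | mul a b ha hb => rw [← mul_assoc, ha, mul_assoc, hb, ← mul_assoc, map_mul]
  | add a b ha hb => rw [mul_add, ha, hb, map_add, add_mul]

/-- Elements of parity `i` and `j` of `Λ(n)` supercommute. -/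
theorem super_comm {i j : ZMod 2} {x y : Grassmann R n} (hx : x ∈ grading R n i)
    (hy : y ∈ grading R n j) : x * y = (-1) ^ (i.val * j.val) * (y * x) := by
  have hz : ∀ p : ZMod 2, p = 0 ∨ p = 1 := by decide
  rcases hz j with rfl | rfl
  · have h : ∀ x : Grassmann R n, x * y = y * x := by
      intro x
      induction x using CliffordAlgebra.induction with
      | algebraMap r => exact Algebra.commutes _ _
      | ι v => rw [ι_mul_eq, CliffordAlgebra.involute_eq_of_mem_even hy]
      | mul a b ha hb => rw [mul_assoc, hb, ← mul_assoc, ha, mul_assoc]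
      | add a b ha hb => rw [mul_add, add_mul, ha, hb]
    rw [h]; simp
  · have h : ∀ x : Grassmann R n, x * y = y * CliffordAlgebra.involute x := by
      intro x
      induction x using CliffordAlgebra.induction with
      | algebraMap r => rw [AlgHom.commutes, Algebra.commutes]
      | ι v =>
        rw [ι_mul_eq, CliffordAlgebra.involute_eq_of_mem_odd hy, CliffordAlgebra.involute_ι,
          neg_mul, mul_neg]
      | mul a b ha hb => rw [mul_assoc, hb, ← mul_assoc, ha, mul_assoc, map_mul]
      | add a b ha hb => rw [map_add, mul_add, add_mul, ha, hb]
    rw [h, involute_eq hx, ZMod.val_one, mul_one, ← mul_assoc, ← mul_assoc]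
    congr 1
    exact ((Commute.neg_one_right y).pow_right _).eq

theorem isSuperDerivation_mul_pderiv (a : Finset (Fin n)) (i : Fin n) :
    IsSuperDerivation ((a.card : ZMod 2) + 1)
      (LinearMap.mulLeft R (monomials R n a) * pderiv R n i) where
  map_mem j x hx := by
    have := SetLike.mul_mem_graded (monomials_mem (R := R) a) (pderiv_mem i hx)
    rwa [← add_assoc, add_comm (a.card : ZMod 2) j, add_assoc] at this
  leibniz j x y hx := by
    show monomials R n a * pderiv R n i (x * y) = monomials R n a * pderiv R n i x * y +
      (-1) ^ (((a.card : ZMod 2) + 1).val * j.val) * (x * (monomials R n a * pderiv R n i y))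
    rw [pderiv_leibniz, involute_eq hx, mul_add, ← mul_assoc, ← mul_assoc x]
    congr 1
    rw [super_comm hx (monomials_mem (R := R) a)]
    have hz : ∀ p : ZMod 2, p = 0 ∨ p = 1 := by decide
    have two : (1 : ZMod 2) + 1 = 0 := by decide
    rcases hz j with rfl | rfl <;> rcases hz (a.card : ZMod 2) with h | h <;>
      simp [h, two, ZMod.val_one, mul_assoc]

variable (R) in
/-- The element `ξ^a ∂_i` of `W(n)`. -/
def chevalleyVec (a : Finset (Fin n)) (i : Fin n) : W R n :=
  ⟨LinearMap.mulLeft R (monomials R n a) * pderiv R n i,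
    superDer_le_W _ (isSuperDerivation_mul_pderiv a i)⟩

/-! ### The admissible lattice -/

variable (R n) in
/-- The lattice `M`: the `ℤ`-span of the monomials in `Λ(n)`, a `ℤ`-subalgebra. -/
def lattice : Subalgebra ℤ (Grassmann R n) where
  carrier := Submodule.span ℤ (Set.range (monomials R n))
  add_mem' h h' := add_mem h h'
  algebraMap_mem' z := by
    show algebraMap ℤ (Grassmann R n) z ∈ Submodule.span ℤ (Set.range (monomials R n))
    rw [Algebra.algebraMap_eq_smul_one, ← monomials_empty]
    exact Submodule.smul_mem _ _ (Submodule.subset_span ⟨_, rfl⟩)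
  mul_mem' := by
    intro x y hx hy
    refine Submodule.span_induction₂ (p := fun x y _ _ =>
      x * y ∈ Submodule.span ℤ (Set.range (monomials R n))) ?_ ?_ ?_ ?_ ?_ ?_ ?_ hx hy
    · rintro _ _ ⟨a, rfl⟩ ⟨b, rfl⟩
      obtain ⟨c, z, h⟩ := monomials_mul (R := R) a b
      rw [h]
      exact Submodule.smul_mem _ _ (Submodule.subset_span ⟨_, rfl⟩)
    · intro y _; rw [zero_mul]; exact zero_mem _
    · intro x _; rw [mul_zero]; exact zero_mem _
    · intro x y z _ _ _ h1 h2; rw [add_mul]; exact add_mem h1 h2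
    · intro x y z _ _ _ h1 h2; rw [mul_add]; exact add_mem h1 h2
    · intro r x y _ _ h; rw [smul_mul_assoc]; exact Submodule.smul_mem _ _ h
    · intro r x y _ _ h; rw [mul_smul_comm]; exact Submodule.smul_mem _ _ h

variable (R n) in
/-- The parity grading of the lattice. -/
def latticeGrading (i : ZMod 2) : Submodule ℤ (lattice R n) :=
  ((grading R n i).restrictScalars ℤ).comap (lattice R n).val.toLinearMap

instance : SetLike.GradedMonoid (latticeGrading R n) where
  one_mem := SetLike.GradedOne.one_mem (A := grading R n)
  mul_mem _ _ _ _ hx hy := SetLike.GradedMul.mul_mem (A := grading R n) hx hy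

theorem latticeGrading_isCompl : IsCompl (latticeGrading R n 0) (latticeGrading R n 1) := by
  constructor
  · rw [Submodule.disjoint_def]
    intro x h0 h1
    exact Subtype.ext (Submodule.disjoint_def.1 (CliffordAlgebra.evenOdd_isCompl
      (0 : QuadraticForm R (Fin n → R))).disjoint _ h0 h1)
  · rw [codisjoint_iff_le_sup]
    rintro ⟨x, hx⟩ _
    refine Submodule.span_induction (p := fun x hx =>
      (⟨x, hx⟩ : lattice R n) ∈ latticeGrading R n 0 ⊔ latticeGrading R n 1) ?_ ?_ ?_ ?_ hx
    · rintro _ ⟨a, rfl⟩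
      have h : ∀ p : ZMod 2, p = 0 ∨ p = 1 := by decide
      have hm := monomials_mem (R := R) a
      rcases h (a.card : ZMod 2) with h | h
      · rw [h] at hm; exact Submodule.mem_sup_left hm
      · rw [h] at hm; exact Submodule.mem_sup_right hm
    · exact zero_mem _
    · intro x y hx hy h1 h2; exact add_mem h1 h2
    · intro r x hx h; exact Submodule.smul_mem _ r h

instance : GradedAlgebra (latticeGrading R n) where
  toDecomposition := (isInternal_of_isCompl _ latticeGrading_isCompl).chooseDecomposition

end Grassmann

/-! ### The `A`-superalgebra `V_A = A ⊗ M = A[ξ_1, …, ξ_n]` -/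

namespace CommSuperAlg
variable {k : Type u} [CommRing k]

/-- The grading of `A`, seen as a superring. -/
def gradingInt (A : CommSuperAlg.{u, v} k) (i : ZMod 2) : Submodule ℤ A :=
  (A.grading i).restrictScalars ℤ

instance (A : CommSuperAlg.{u, v} k) : SetLike.GradedMonoid A.gradingInt where
  one_mem := SetLike.GradedOne.one_mem (A := A.grading)
  mul_mem _ _ _ _ hx hy := SetLike.GradedMul.mul_mem (A := A.grading) hx hy

instance (A : CommSuperAlg.{u, v} k) : GradedAlgebra A.gradingInt where
  toDecomposition := (isInternal_of_isCompl A.gradingInt (by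
    have h := isCompl_even_odd A.grading
    constructor
    · rw [Submodule.disjoint_def]
      exact fun x h0 h1 => Submodule.disjoint_def.1 h.disjoint x h0 h1
    · rw [codisjoint_iff_le_sup]
      intro x _
      obtain ⟨y, hy, z, hz, rfl⟩ := exists_even_add_odd A.grading x
      exact Submodule.add_mem_sup hy hz)).chooseDecomposition

variable (𝕂 : Type w) [CommRing 𝕂] (n : ℕ)

/-- `V_A = A ⊗_ℤ M`, with the sign rule for the product
`(a ⊗ m) (a' ⊗ m') = (-1) ^ (|m| |a'|) a a' ⊗ m m'`. -/
def V (A : CommSuperAlg.{u, v} k) : Type (max v w) :=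
  GradedTensorProduct ℤ A.gradingInt (Grassmann.latticeGrading 𝕂 n)

namespace V

instance (A : CommSuperAlg.{u, v} k) : Ring (V 𝕂 n A) :=
  inferInstanceAs (Ring (GradedTensorProduct ℤ A.gradingInt (Grassmann.latticeGrading 𝕂 n)))

/-- The inclusion `a ↦ a ⊗ 1`. -/
def scalar (A : CommSuperAlg.{u, v} k) : A →+* V 𝕂 n A :=
  GradedTensorProduct.includeLeftRingHom A.gradingInt (Grassmann.latticeGrading 𝕂 n)

instance (A : CommSuperAlg.{u, v} k) : Module A (V 𝕂 n A) := Module.compHom _ (scalar 𝕂 n A)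

variable {𝕂 n} {A B C : CommSuperAlg.{u, v} k}

/-- The pure tensor `a ⊗ m`. -/
def tmul (a : A) (m : Grassmann.lattice 𝕂 n) : V 𝕂 n A :=
  GradedTensorProduct.tmul ℤ (𝒜 := A.gradingInt) (ℬ := Grassmann.latticeGrading 𝕂 n) a m

theorem smul_def (a : A) (x : V 𝕂 n A) : a • x = scalar 𝕂 n A a * x := rfl

theorem add_tmul (a b : A) (m : Grassmann.lattice 𝕂 n) : tmul (a + b) m = tmul a m + tmul b m :=
  (congrArg (GradedTensorProduct.of ℤ A.gradingInt (Grassmann.latticeGrading 𝕂 n))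
    (TensorProduct.add_tmul a b m)).trans (map_add _ _ _)

theorem tmul_add (a : A) (m m' : Grassmann.lattice 𝕂 n) :
    tmul a (m + m') = tmul a m + tmul a m' :=
  (congrArg (GradedTensorProduct.of ℤ A.gradingInt (Grassmann.latticeGrading 𝕂 n))
    (TensorProduct.tmul_add a m m')).trans (map_add _ _ _)

theorem zero_tmul (m : Grassmann.lattice 𝕂 n) : tmul (0 : A) m = 0 := by
  have h := add_tmul (0 : A) 0 m
  rwa [add_zero, left_eq_add] at h

theorem tmul_mul_tmul {i j : ZMod 2} (a a' : A) (m m' : Grassmann.lattice 𝕂 n)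
    (ha : a' ∈ A.grading i) (hm : m ∈ Grassmann.latticeGrading 𝕂 n j) :
    tmul a m * tmul a' m' = (-1 : ℤˣ) ^ (j * i) • tmul (a * a') (m * m') :=
  GradedTensorProduct.tmul_coe_mul_coe_tmul A.gradingInt (Grassmann.latticeGrading 𝕂 n)
    a ⟨m, hm⟩ ⟨a', ha⟩ m'

theorem smul_tmul (b a : A) (m : Grassmann.lattice 𝕂 n) : b • tmul a m = tmul (b * a) m := by
  have h : ∀ (i : ZMod 2) (a : A), a ∈ A.grading i → b • tmul a m = tmul (b * a) m := by
    intro i a ha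
    refine (tmul_mul_tmul b a 1 m ha (j := 0) (SetLike.GradedOne.one_mem)).trans ?_
    rw [zero_mul, uzpow_zero, one_smul, one_mul]
  obtain ⟨x, hx, y, hy, rfl⟩ := exists_even_add_odd A.grading a
  rw [add_tmul, smul_add, h _ _ hx, h _ _ hy, mul_add, add_tmul]

theorem tmul_eq (a : A) (m : Grassmann.lattice 𝕂 n) : tmul a m = a • tmul 1 m := by
  rw [smul_tmul, mul_one]

theorem one_eq : (1 : V 𝕂 n A) = tmul 1 1 := rfl

theorem induction_on {p : V 𝕂 n A → Prop} (x : V 𝕂 n A) (h0 : p 0)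
    (ht : ∀ a m, p (tmul a m)) (ha : ∀ x y, p x → p y → p (x + y)) : p x :=
  TensorProduct.induction_on (motive := p) (x : A ⊗[ℤ] Grassmann.lattice 𝕂 n) h0 ht ha

/-- The parity grading of `V_A`. -/
def grading (𝕂 : Type w) [CommRing 𝕂] (n : ℕ) (A : CommSuperAlg.{u, v} k) (p : ZMod 2) :
    AddSubgroup (V 𝕂 n A) :=
  AddSubgroup.closure {x | ∃ (i j : ZMod 2) (a : A) (m : Grassmann.lattice 𝕂 n),
    a ∈ A.grading i ∧ m ∈ Grassmann.latticeGrading 𝕂 n j ∧ i + j = p ∧ x = tmul a m}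

theorem tmul_mem {i j : ZMod 2} {a : A} {m : Grassmann.lattice 𝕂 n} (ha : a ∈ A.grading i)
    (hm : m ∈ Grassmann.latticeGrading 𝕂 n j) : tmul a m ∈ grading 𝕂 n A (i + j) :=
  AddSubgroup.subset_closure ⟨i, j, a, m, ha, hm, rfl, rfl⟩

theorem one_tmul_mem {j : ZMod 2} {m : Grassmann.lattice 𝕂 n}
    (hm : m ∈ Grassmann.latticeGrading 𝕂 n j) : tmul (1 : A) m ∈ grading 𝕂 n A j := by
  simpa using tmul_mem (A := A) (SetLike.one_mem_graded A.grading) hm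

theorem smul_mem {i j : ZMod 2} {a : A} {x : V 𝕂 n A} (ha : a ∈ A.grading i)
    (hx : x ∈ grading 𝕂 n A j) : a • x ∈ grading 𝕂 n A (i + j) := by
  induction hx using AddSubgroup.closure_induction with
  | mem x hx =>
    obtain ⟨p, q, b, m, hb, hm, rfl, rfl⟩ := hx
    rw [smul_tmul, ← add_assoc]
    exact tmul_mem (SetLike.mul_mem_graded ha hb) hm
  | zero => rw [smul_zero]; exact zero_mem _
  | add x y _ _ h1 h2 => rw [smul_add]; exact add_mem h1 h2
  | neg x _ h => rw [smul_neg]; exact neg_mem h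

/-- Moving a scalar past a homogeneous element. -/
theorem mul_smul_of_mem {i j : ZMod 2} {a : A} {x : V 𝕂 n A} (ha : a ∈ A.grading i)
    (hx : x ∈ grading 𝕂 n A j) (y : V 𝕂 n A) :
    x * (a • y) = (-1 : ℤˣ) ^ (j * i) • (a • (x * y)) := by
  have key : x * scalar 𝕂 n A a = (-1 : ℤˣ) ^ (j * i) • (scalar 𝕂 n A a * x) := by
    induction hx using AddSubgroup.closure_induction with
    | mem x hx =>
      obtain ⟨p, q, b, m, hb, hm, rfl, rfl⟩ := hx
      rw [← smul_def, smul_tmul]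
      refine (tmul_mul_tmul b a m 1 ha hm).trans ?_
      rw [mul_one, A.super_comm p i b a hb ha]
      have hz : ∀ p : ZMod 2, p = 0 ∨ p = 1 := by decide
      have two : (1 : ZMod 2) + 1 = 0 := by decide
      have neg : ∀ c : A, tmul (-c) m = -tmul c m := fun c =>
        eq_neg_of_add_eq_zero_left (by rw [← add_tmul, neg_add_cancel]; exact zero_tmul m)
      rcases hz p with rfl | rfl <;> rcases hz q with rfl | rfl <;> rcases hz i with rfl | rfl <;>
        simp [ZMod.val_one, two, neg]
    | zero => simp
    | add x y _ _ h1 h2 => rw [add_mul, h1, h2, mul_add, smul_add]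
    | neg x _ h => rw [neg_mul, h, mul_neg, smul_neg]
  rw [smul_def, smul_def, ← mul_assoc, key, smul_mul_assoc, mul_assoc]

/-- The additive map `b ⊗ m ↦ b • f m`. -/
def extendAdd (f : Grassmann.lattice 𝕂 n →+ V 𝕂 n B) : V 𝕂 n B →+ V 𝕂 n B :=
  (TensorProduct.liftAddHom (((smulAddHom B (V 𝕂 n B)).flip.comp f).flip)
    (fun r b m => by
      show (r • b) • f m = b • f (r • m)
      have h1 := ((smulAddHom B (V 𝕂 n B)).flip (f m)).map_zsmul r b
      have h2 := (smulAddHom B (V 𝕂 n B) b).map_zsmul r (f m)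
      rw [map_zsmul f]
      exact h1.trans h2.symm) : B ⊗[ℤ] Grassmann.lattice 𝕂 n →+ V 𝕂 n B)

theorem extendAdd_tmul (f : Grassmann.lattice 𝕂 n →+ V 𝕂 n B) (b : B)
    (m : Grassmann.lattice 𝕂 n) : extendAdd f (tmul b m) = b • f m := rfl

/-- `V_B` is obtained from `M` by extension of scalars: the `B`-linear map with
`b ⊗ m ↦ b • f m`. -/
def extend (f : Grassmann.lattice 𝕂 n →+ V 𝕂 n B) : V 𝕂 n B →ₗ[B] V 𝕂 n B where
  toFun := extendAdd f
  map_add' := map_add _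
  map_smul' b x := by
    rw [RingHom.id_apply]
    induction x using induction_on with
    | h0 => rw [smul_zero, map_zero, smul_zero]
    | ht a m => rw [smul_tmul, extendAdd_tmul, extendAdd_tmul, mul_smul]
    | ha x y h1 h2 => rw [smul_add, map_add, h1, h2, map_add, smul_add]

@[simp] theorem extend_tmul (f : Grassmann.lattice 𝕂 n →+ V 𝕂 n B) (b : B)
    (m : Grassmann.lattice 𝕂 n) : extend f (tmul b m) = b • f m := rfl

theorem linearMap_ext {f g : V 𝕂 n A →ₗ[A] V 𝕂 n A}
    (h : ∀ m, f (tmul 1 m) = g (tmul 1 m)) : f = g := by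
  ext x
  induction x using induction_on with
  | h0 => simp
  | ht a m => rw [tmul_eq, map_smul, map_smul, h]
  | ha x y h1 h2 => rw [map_add, map_add, h1, h2]

theorem evenOdd_ext {f g : V 𝕂 n A →+ V 𝕂 n B}
    (h : ∀ (i j : ZMod 2) (a : A) (m : Grassmann.lattice 𝕂 n), a ∈ A.grading i →
      m ∈ Grassmann.latticeGrading 𝕂 n j → f (tmul a m) = g (tmul a m)) (x : V 𝕂 n A) :
    f x = g x := by
  induction x using induction_on with
  | h0 => simp
  | ht a m =>
    obtain ⟨a, ha, b, hb, rfl⟩ := exists_even_add_odd A.grading a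
    obtain ⟨m, hm, l, hl, rfl⟩ := exists_even_add_odd (Grassmann.latticeGrading 𝕂 n) m
    simp only [add_tmul, tmul_add, map_add]
    rw [h _ _ _ _ ha hm, h _ _ _ _ hb hm, h _ _ _ _ ha hl, h _ _ _ _ hb hl]
  | ha x y h1 h2 => rw [map_add, map_add, h1, h2]

/-- The additive map `V_A → V_B`, `a ⊗ m ↦ φ(a) ⊗ m`. -/
def mapAdd (𝕂 : Type w) [CommRing 𝕂] (n : ℕ) (φ : A ⟶ B) : V 𝕂 n A →+ V 𝕂 n B :=
  (TensorProduct.map ((homAlg φ).toRingHom.toAddMonoidHom.toIntLinearMap)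
    (LinearMap.id : Grassmann.lattice 𝕂 n →ₗ[ℤ] _)).toAddMonoidHom

@[simp] theorem mapAdd_tmul (φ : A ⟶ B) (a : A) (m : Grassmann.lattice 𝕂 n) :
    mapAdd 𝕂 n φ (tmul a m) = tmul (homAlg φ a) m := rfl

theorem mapAdd_smul (φ : A ⟶ B) (a : A) (x : V 𝕂 n A) :
    mapAdd 𝕂 n φ (a • x) = homAlg φ a • mapAdd 𝕂 n φ x := by
  induction x using induction_on with
  | h0 => simp
  | ht b m => rw [smul_tmul, mapAdd_tmul, mapAdd_tmul, smul_tmul, map_mul]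
  | ha x y h1 h2 => rw [smul_add, map_add, h1, h2, map_add, smul_add]

theorem mapAdd_mem (φ : A ⟶ B) {p : ZMod 2} {x : V 𝕂 n A} (hx : x ∈ grading 𝕂 n A p) :
    mapAdd 𝕂 n φ x ∈ grading 𝕂 n B p := by
  induction hx using AddSubgroup.closure_induction with
  | mem x hx =>
    obtain ⟨p, q, b, m, hb, hm, rfl, rfl⟩ := hx
    rw [mapAdd_tmul]
    exact tmul_mem (homAlg_mem φ hb) hm
  | zero => rw [map_zero]; exact zero_mem _
  | add x y _ _ h1 h2 => rw [map_add]; exact add_mem h1 h2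
  | neg x _ h => rw [map_neg]; exact neg_mem h

theorem smul_mul (a : A) (x y : V 𝕂 n A) : (a • x) * y = a • (x * y) := mul_assoc _ _ _

theorem one_tmul_mul (m m' : Grassmann.lattice 𝕂 n) :
    (tmul 1 m * tmul 1 m' : V 𝕂 n A) = tmul 1 (m * m') := by
  obtain ⟨x, hx, y, hy, rfl⟩ := exists_even_add_odd (Grassmann.latticeGrading 𝕂 n) m
  rw [tmul_add, add_mul, tmul_mul_tmul _ _ _ _ (SetLike.one_mem_graded A.grading) hx,
    tmul_mul_tmul _ _ _ _ (SetLike.one_mem_graded A.grading) hy]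
  simp [add_mul, tmul_add]

theorem mapAdd_mul (φ : A ⟶ B) (x y : V 𝕂 n A) :
    mapAdd 𝕂 n φ (x * y) = mapAdd 𝕂 n φ x * mapAdd 𝕂 n φ y := by
  refine evenOdd_ext (f := (mapAdd 𝕂 n φ).comp (AddMonoidHom.mulRight y))
    (g := (AddMonoidHom.mulRight (mapAdd 𝕂 n φ y)).comp (mapAdd 𝕂 n φ)) (fun i j a m ha hm => ?_) x
  refine evenOdd_ext (f := (mapAdd 𝕂 n φ).comp (AddMonoidHom.mulLeft (tmul a m)))
    (g := (AddMonoidHom.mulLeft (mapAdd 𝕂 n φ (tmul a m))).comp (mapAdd 𝕂 n φ))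
    (fun i' j' a' m' ha' hm' => ?_) y
  show mapAdd 𝕂 n φ (tmul a m * tmul a' m') = mapAdd 𝕂 n φ (tmul a m) * mapAdd 𝕂 n φ (tmul a' m')
  rw [tmul_mul_tmul _ _ _ _ ha' hm, mapAdd_tmul, mapAdd_tmul,
    tmul_mul_tmul _ _ _ _ (homAlg_mem φ ha') hm, Units.smul_def, Units.smul_def, map_zsmul,
    mapAdd_tmul, map_mul]

/-- Extension of scalars of an `A`-linear endomorphism of `V_A` along `φ : A ⟶ B`. -/
def baseChange (φ : A ⟶ B) (g : V 𝕂 n A →ₗ[A] V 𝕂 n A) : V 𝕂 n B →ₗ[B] V 𝕂 n B :=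
  extend
    { toFun := fun m => mapAdd 𝕂 n φ (g (tmul 1 m))
      map_zero' := by
        have h : (tmul 1 0 : V 𝕂 n A) = 0 := by
          have h := tmul_add (1 : A) (0 : Grassmann.lattice 𝕂 n) 0
          rwa [add_zero, left_eq_add] at h
        rw [h, map_zero, map_zero]
      map_add' := fun m m' => by rw [tmul_add, map_add, map_add] }

theorem baseChange_one_tmul (φ : A ⟶ B) (g : V 𝕂 n A →ₗ[A] V 𝕂 n A)
    (m : Grassmann.lattice 𝕂 n) :
    baseChange φ g (tmul 1 m) = mapAdd 𝕂 n φ (g (tmul 1 m)) :=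
  one_smul B (mapAdd 𝕂 n φ (g (tmul 1 m)))

theorem baseChange_mapAdd (φ : A ⟶ B) (g : V 𝕂 n A →ₗ[A] V 𝕂 n A) (x : V 𝕂 n A) :
    baseChange φ g (mapAdd 𝕂 n φ x) = mapAdd 𝕂 n φ (g x) := by
  induction x using induction_on with
  | h0 => simp
  | ht a m =>
    rw [tmul_eq, mapAdd_smul, map_smul, map_smul, mapAdd_smul, mapAdd_tmul, map_one,
      baseChange_one_tmul]
  | ha x y h1 h2 => rw [map_add, map_add, h1, h2, map_add, map_add]

theorem baseChange_id (φ : A ⟶ B) :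
    baseChange φ (LinearMap.id : V 𝕂 n A →ₗ[A] V 𝕂 n A) = LinearMap.id :=
  linearMap_ext fun m => by simp [baseChange_one_tmul]

theorem baseChange_comp (φ : A ⟶ B) (g h : V 𝕂 n A →ₗ[A] V 𝕂 n A) :
    baseChange φ (g ∘ₗ h) = baseChange φ g ∘ₗ baseChange φ h :=
  linearMap_ext fun m => by
    rw [baseChange_one_tmul, LinearMap.comp_apply, LinearMap.comp_apply, baseChange_one_tmul,
      baseChange_mapAdd]

theorem baseChange_mem (φ : A ⟶ B) {g : V 𝕂 n A →ₗ[A] V 𝕂 n A}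
    (hg : ∀ p x, x ∈ grading 𝕂 n A p → g x ∈ grading 𝕂 n A p) {p : ZMod 2} {x : V 𝕂 n B}
    (hx : x ∈ grading 𝕂 n B p) : baseChange φ g x ∈ grading 𝕂 n B p := by
  induction hx using AddSubgroup.closure_induction with
  | mem x hx =>
    obtain ⟨p, q, b, m, hb, hm, rfl, rfl⟩ := hx
    rw [tmul_eq, map_smul, baseChange_one_tmul]
    exact smul_mem hb (mapAdd_mem φ (hg _ _ (one_tmul_mem hm)))
  | zero => rw [map_zero]; exact zero_mem _
  | add x y _ _ h1 h2 => rw [map_add]; exact add_mem h1 h2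
  | neg x _ h => rw [map_neg]; exact neg_mem h

theorem baseChange_mul (φ : A ⟶ B) {g : V 𝕂 n A →ₗ[A] V 𝕂 n A}
    (hg : ∀ p x, x ∈ grading 𝕂 n A p → g x ∈ grading 𝕂 n A p)
    (hm : ∀ x y, g (x * y) = g x * g y) (x y : V 𝕂 n B) :
    baseChange φ g (x * y) = baseChange φ g x * baseChange φ g y := by
  refine evenOdd_ext (f := (baseChange φ g).toAddMonoidHom.comp (AddMonoidHom.mulRight y))
    (g := (AddMonoidHom.mulRight (baseChange φ g y)).comp (baseChange φ g).toAddMonoidHom)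
    (fun i j a m ha hm => ?_) x
  refine evenOdd_ext (f := (baseChange φ g).toAddMonoidHom.comp (AddMonoidHom.mulLeft (tmul a m)))
    (g := (AddMonoidHom.mulLeft (baseChange φ g (tmul a m))).comp (baseChange φ g).toAddMonoidHom)
    (fun i' j' a' m' ha' hm' => ?_) y
  show baseChange φ g (tmul a m * tmul a' m') = baseChange φ g (tmul a m) *
    baseChange φ g (tmul a' m')
  rw [tmul_eq a, tmul_eq a', smul_mul, mul_smul_of_mem ha' (one_tmul_mem hm), one_tmul_mul]
  simp only [map_smul, baseChange_one_tmul]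
  rw [smul_mul, mul_smul_of_mem ha' (mapAdd_mem φ (hg _ _ (one_tmul_mem hm))), ← mapAdd_mul,
    ← ‹∀ x y, g (x * y) = g x * g y›, one_tmul_mul]
  simp only [Units.smul_def, map_zsmul, map_smul, baseChange_one_tmul]

end V
end CommSuperAlg

/-! ### The supergroup `G_{Λ(n)}` -/

namespace CommSuperAlg
namespace V
variable {k : Type u} [CommRing k]

theorem mapAdd_id {𝕂 : Type w} [CommRing 𝕂] {n : ℕ} {A : CommSuperAlg.{u, v} k} (x : V 𝕂 n A) :
    mapAdd 𝕂 n (𝟙 A) x = x := by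
  induction x using induction_on with
  | h0 => simp
  | ht a m => rfl
  | ha x y h1 h2 => rw [map_add, h1, h2]

theorem mapAdd_comp {𝕂 : Type w} [CommRing 𝕂] {n : ℕ} {A B C : CommSuperAlg.{u, v} k} (φ : A ⟶ B)
    (ψ : B ⟶ C) (x : V 𝕂 n A) : mapAdd 𝕂 n (φ ≫ ψ) x = mapAdd 𝕂 n ψ (mapAdd 𝕂 n φ x) := by
  induction x using induction_on with
  | h0 => simp
  | ht a m => rfl
  | ha x y h1 h2 => rw [map_add, h1, h2, map_add, map_add]

/-- `GL(V_A)`: the group of parity preserving `A`-linear automorphisms of `V_A`. -/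
def SuperGL (𝕂 : Type w) [CommRing 𝕂] (n : ℕ) (A : CommSuperAlg.{u, v} k) :
    Subgroup (V 𝕂 n A ≃ₗ[A] V 𝕂 n A) where
  carrier := {g | ∀ p x, g x ∈ grading 𝕂 n A p ↔ x ∈ grading 𝕂 n A p}
  one_mem' _ _ := Iff.rfl
  mul_mem' hg hh p x := (hg p _).trans (hh p x)
  inv_mem' {g} hg p x := by
    refine (hg p _).symm.trans ?_
    rw [show g (g⁻¹ x) = x from g.apply_symm_apply x]

section
variable {𝕂 : Type w} [CommRing 𝕂] {n : ℕ} {A B C : CommSuperAlg.{u, v} k}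

/-- The map `GL(V_A) → GL(V_B)` given by extension of scalars along `φ : A ⟶ B`. -/
def SuperGL.map (φ : A ⟶ B) : SuperGL 𝕂 n A →* SuperGL 𝕂 n B where
  toFun g :=
    ⟨LinearEquiv.ofLinearMap (baseChange φ g.1) (baseChange φ g.1.symm)
        (by rw [← baseChange_comp, LinearEquiv.comp_coe, LinearEquiv.symm_trans_self,
              LinearEquiv.refl_toLinearMap, baseChange_id])
        (by rw [← baseChange_comp, LinearEquiv.comp_coe, LinearEquiv.self_trans_symm,
              LinearEquiv.refl_toLinearMap, baseChange_id]), fun p x => by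
        refine ⟨fun h => ?_, fun h => baseChange_mem φ (fun p x => (g.2 p x).2) h⟩
        have h2 := baseChange_mem φ (g := (g.1.symm : V 𝕂 n A →ₗ[A] V 𝕂 n A))
          (fun p x hx => ((g⁻¹).2 p x).2 hx) h
        have h3 : baseChange φ (g.1.symm : V 𝕂 n A →ₗ[A] V 𝕂 n A) (baseChange φ g.1 x) = x := by
          rw [← LinearMap.comp_apply, ← baseChange_comp, LinearEquiv.comp_coe,
            LinearEquiv.self_trans_symm, LinearEquiv.refl_toLinearMap, baseChange_id,
            LinearMap.id_apply]
        exact h3 ▸ h2⟩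
  map_one' := Subtype.ext (LinearEquiv.toLinearMap_injective (baseChange_id φ))
  map_mul' g h := Subtype.ext (LinearEquiv.toLinearMap_injective
    (baseChange_comp φ g.1.toLinearMap h.1.toLinearMap))

theorem SuperGL.map_apply (φ : A ⟶ B) (g : SuperGL 𝕂 n A) (x : V 𝕂 n B) :
    (SuperGL.map φ g).1 x = baseChange φ g.1 x := rfl

theorem SuperGL.map_one_tmul (φ : A ⟶ B) (g : SuperGL 𝕂 n A) (m : Grassmann.lattice 𝕂 n) :
    (SuperGL.map φ g).1 (tmul 1 m) = mapAdd 𝕂 n φ (g.1 (tmul 1 m)) := baseChange_one_tmul _ _ _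

theorem SuperGL.ext {g h : SuperGL 𝕂 n A} (e : ∀ m, g.1 (tmul 1 m) = h.1 (tmul 1 m)) : g = h :=
  Subtype.ext (LinearEquiv.toLinearMap_injective (linearMap_ext e))

end

/-- The group functor `GL(V_•)`. -/
def SuperGLFunctor (𝕂 : Type w) [CommRing 𝕂] (k : Type u) [CommRing k] (n : ℕ) :
    CommSuperAlg.{u, v} k ⥤ GrpCat.{max v w} where
  obj A := GrpCat.of (SuperGL 𝕂 n A)
  map φ := GrpCat.ofHom (SuperGL.map φ)
  map_id A := GrpCat.hom_ext (MonoidHom.ext fun g => SuperGL.ext fun m => by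
    exact (SuperGL.map_one_tmul _ g m).trans (mapAdd_id _))
  map_comp {A B C} φ ψ := GrpCat.hom_ext (MonoidHom.ext fun g => SuperGL.ext fun m => by
    refine (SuperGL.map_one_tmul _ g m).trans ((mapAdd_comp φ ψ _).trans ?_)
    exact ((SuperGL.map_one_tmul ψ (SuperGL.map φ g) m).trans
      (congrArg _ (SuperGL.map_one_tmul φ g m))).symm)

/-- The group functor `Aut(Λ(n))`, as a subgroup functor of `GL(V_•)`: on `A` it consists of the
`A`-linear superalgebra automorphisms of `V_A = A[ξ_1, …, ξ_n]`. -/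
def autFunctor (𝕂 : Type w) [CommRing 𝕂] (k : Type u) [CommRing k] (n : ℕ) :
    SubgroupFunctor (SuperGLFunctor.{u, v, w} 𝕂 k n) where
  obj A :=
    { carrier := {g : SuperGL 𝕂 n A | g.1 1 = 1 ∧ ∀ x y, g.1 (x * y) = g.1 x * g.1 y}
      one_mem' := ⟨rfl, fun _ _ => rfl⟩
      mul_mem' := by
        rintro (g : SuperGL 𝕂 n A) (h : SuperGL 𝕂 n A) ⟨g1, hg⟩ ⟨h1, hh⟩
        refine ⟨?_, fun x y => ?_⟩
        · show g.1 (h.1 1) = 1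
          rw [h1, g1]
        · show g.1 (h.1 (x * y)) = g.1 (h.1 x) * g.1 (h.1 y)
          rw [hh, hg]
      inv_mem' := by
        rintro (g : SuperGL 𝕂 n A) ⟨g1, hg⟩
        refine ⟨?_, fun x y => ?_⟩
        · show g.1.symm 1 = 1
          rw [LinearEquiv.symm_apply_eq, g1]
        · show g.1.symm (x * y) = g.1.symm x * g.1.symm y
          rw [LinearEquiv.symm_apply_eq, hg, LinearEquiv.apply_symm_apply,
            LinearEquiv.apply_symm_apply] }
  map {A B} φ := by
    rintro (g : SuperGL 𝕂 n A) ⟨g1, hg⟩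
    refine ⟨?_, fun x y => baseChange_mul φ (fun p x => (g.2 p x).2) hg x y⟩
    show (SuperGL.map φ g).1 1 = 1
    rw [one_eq, SuperGL.map_one_tmul, ← one_eq, g1, one_eq, mapAdd_tmul, map_one]

section
variable {𝕂 : Type w} [Field 𝕂] {n : ℕ} {A B : CommSuperAlg.{u, v} k}

/-- `g = exp(t X) = ∑_r t^r X^r / r!` on `V_A`, where `X` is a nilpotent endomorphism of `Λ(n)`
whose divided powers `X^r / r!` preserve the lattice `M`. -/
def IsExp (X : Module.End 𝕂 (Grassmann 𝕂 n)) (t : A) (g : V 𝕂 n A ≃ₗ[A] V 𝕂 n A) : Prop :=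
  ∃ D : ℕ → Grassmann.lattice 𝕂 n → Grassmann.lattice 𝕂 n,
    (∀ r m, (D r m : Grassmann 𝕂 n) = (r.factorial : 𝕂)⁻¹ • (X ^ r) (m : Grassmann 𝕂 n)) ∧
    ∀ m, g (tmul 1 m) = ∑ r ∈ Finset.range (nilpotencyClass X), tmul (t ^ r) (D r m)

/-- `m` is a vector of weight `μ`, i.e. `H_j m = μ_j m` for the toral elements `H_j = ξ_j ∂_j`. -/
def IsWeightVector (μ : Fin n → ℤ) (m : Grassmann 𝕂 n) : Prop :=
  ∀ j, (Grassmann.chevalleyVec 𝕂 {j} j : Module.End 𝕂 (Grassmann 𝕂 n)) m = (μ j : 𝕂) • m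

/-- `g = h_H(u)` for `H = ∑_j z_j H_j` and `u ∈ U(A₀)`: multiplication by `u ^ μ(H)` on vectors of
weight `μ`. -/
def IsTorus (z : Fin n → ℤ) (u : A.evenˣ) (g : V 𝕂 n A ≃ₗ[A] V 𝕂 n A) : Prop :=
  ∀ (μ : Fin n → ℤ) (m : Grassmann.lattice 𝕂 n), IsWeightVector μ (m : Grassmann 𝕂 n) →
    g (tmul 1 m) = tmul (((u ^ (∑ j, z j * μ j) : A.evenˣ) : A.even) : A) m

/-- The generators of `G_{Λ(n)}(A)`: the toral elements `h_H(u)`, and the one-parameter elements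
`x_α(t) = exp(t X_α)`, for the root vectors `X_α = ξ^a ∂_i` (`a ≠ {i}`) of the Chevalley basis and
`t` in `A` of the same parity as `X_α`. -/
def IsGenerator (g : SuperGL 𝕂 n A) : Prop :=
  (∃ (z : Fin n → ℤ) (u : A.evenˣ), IsTorus z u g.1) ∨
  ∃ (a : Finset (Fin n)) (i : Fin n) (t : A), a ≠ {i} ∧
    t ∈ A.grading ((a.card : ZMod 2) + 1) ∧ IsExp (Grassmann.chevalleyVec 𝕂 a i).1 t g.1

theorem IsGenerator.map (φ : A ⟶ B) {g : SuperGL 𝕂 n A} (hg : IsGenerator g) :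
    IsGenerator (SuperGL.map φ g) := by
  rcases hg with ⟨z, u, h⟩ | ⟨a, i, t, ha, ht, D, hD, h⟩
  · refine Or.inl ⟨z, Units.map (mapEven φ).toMonoidHom u, fun μ m hm => ?_⟩
    rw [SuperGL.map_one_tmul, h μ m hm, mapAdd_tmul, ← map_zpow]
    rfl
  · refine Or.inr ⟨a, i, homAlg φ t, ha, homAlg_mem φ ht, D, hD, fun m => ?_⟩
    rw [SuperGL.map_one_tmul, h m, map_sum]
    simp only [mapAdd_tmul, map_pow]

end

/-- The group functor `A ↦ G_{Λ(n)}(A)`, the subgroup of `GL(V_A)` generated by the toral and the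
one-parameter elements. -/
def groupFunctor (𝕂 : Type w) [Field 𝕂] (k : Type u) [CommRing k] (n : ℕ) :
    SubgroupFunctor (SuperGLFunctor.{u, v, w} 𝕂 k n) where
  obj A := Subgroup.closure {g : SuperGL 𝕂 n A | IsGenerator g}
  map {A B} φ g hg := by
    have h : Subgroup.closure {g : SuperGL 𝕂 n A | IsGenerator g} ≤
        (Subgroup.closure {g : SuperGL 𝕂 n B | IsGenerator g}).comap (SuperGL.map φ) :=
      (Subgroup.closure_le _).2 fun g hg => Subgroup.subset_closure (IsGenerator.map φ hg)
    exact h hg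

/-- The supergroup `𝐆_{Λ(n)}`: the Zariski sheafification of `A ↦ G_{Λ(n)}(A)`. -/
def supergroup (𝕂 : Type w) [Field 𝕂] (k : Type u) [CommRing k] (n : ℕ) :
    SubgroupFunctor (SuperGLFunctor.{u, v, w} 𝕂 k n) :=
  (groupFunctor 𝕂 k n).sheafify (zariski k)

end V
end CommSuperAlg

end

noncomputable section

open CommSuperAlg Opposite

/-! ### The operators ξ^a ∂_i on monomials and on the integral lattice -/

namespace Grassmann

variable {R : Type w} [CommRing R] {n : ℕ}

/-! The inclusion of the supergroup in the automorphisms is a check on generators. A root vector X =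
ξ^a ∂_i with a ≠ {i} satisfies X² = 0, so exp(tX) = 1 + tX. This map is multiplicative because tX(x)
· tX(y) = 0: if X is odd then t² = 0, and if X is even then 0 = X²(xy) = 2 X(x) X(y) (`isExp_mul`).
Toral elements scale ξ^a by a character multiplicative in disjoint unions (`isTorus_mul`). Being an
automorphism is a system of equations in a free module, and these can be tested on a Zariski
covering (`localGroup_le_autGroup`).

Conversely, an automorphism g is determined by the images of the ξ_i, and replacing g by g · exp(tX)
adds t g(ξ^a) to g(ξ_i) and leaves the other images alone (`exists_mul_root`). The coefficient of
ξ^a in g(ξ_i) has the parity of ξ^a ∂_i, so it is always an admissible parameter t. Three reductions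
lead to the identity. The constant terms are removed with the ∂_i (`exists_kill_constant`); after
that g respects the filtration by degree in the ξ_i. The linear part is then a matrix over A₀, which
is brought to the identity by Gaussian elimination with the ξ_j ∂_i and the torus
(`IsReduced.exists_pivot`, `IsReduced.exists_clear`). Finally the terms of degree 2, 3, … are
removed one degree at a time (`exists_kill_degree`), which stops because degrees above n vanish.

Only the elimination needs localization: the entries of a column available as pivots generate the
unit ideal of A₀ (`IsReduced.span_col`) but none need be a unit. Inverting each of them in turn
gives a covering, and the local character of the sheafification allows the argument to be iterated
column by column (`IsReduced.mem_localGroup`). -/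

theorem monomials_mul_of_disjoint {a b : Finset (Fin n)} (h : Disjoint a b) :
    ∃ z : ℤˣ, monomials R n a * monomials R n b = z • monomials R n (a ∪ b) := by
  have h1 := ExteriorAlgebra.basis_mul_of_disjoint (Pi.basisFun R (Fin n))
    (m := a.card) (n := b.card) ⟨a, rfl⟩ ⟨b, rfl⟩ h
  rw [Set.powersetCard.coe_disjUnion, Finset.disjUnion_eq_union] at h1
  exact ⟨_, h1⟩

theorem monomials_mul_of_not_disjoint {a b : Finset (Fin n)} (h : ¬Disjoint a b) :
    monomials R n a * monomials R n b = 0 :=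
  ExteriorAlgebra.basis_mul_of_not_disjoint (Pi.basisFun R (Fin n))
    (m := a.card) (n := b.card) ⟨a, rfl⟩ ⟨b, rfl⟩ h

theorem monomials_singleton (i : Fin n) :
    monomials R n {i} = CliffordAlgebra.ι 0 (Pi.single i 1) := by
  rw [monomials, ExteriorAlgebra.basis_apply_ofCard _ (Finset.card_singleton i)]
  have h := (Set.powersetCard.mem_range_ofFinEmbEquiv_symm_iff_mem
    (Set.powersetCard.ofCard (Finset.card_singleton i)) i).2 (Finset.mem_singleton_self i)
  obtain ⟨l, hl⟩ := h
  rw [Subsingleton.elim l 0] at hl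
  simp [ExteriorAlgebra.ιMulti_family, ExteriorAlgebra.ιMulti_apply, ExteriorAlgebra.ι, hl]

theorem monomials_eq_singleton_mul {i : Fin n} {a : Finset (Fin n)} (h : i ∈ a) :
    ∃ z : ℤˣ, monomials R n a = z • (monomials R n {i} * monomials R n (a.erase i)) := by
  obtain ⟨z, hz⟩ := monomials_mul_of_disjoint (R := R)
    (Finset.disjoint_singleton_left.2 (Finset.notMem_erase i a))
  refine ⟨z⁻¹, ?_⟩
  rw [hz, inv_smul_smul, ← Finset.insert_eq, Finset.insert_erase h]

theorem pderiv_singleton_mul (i j : Fin n) (y : Grassmann R n) :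
    pderiv R n j (monomials R n {i} * y) =
      (if i = j then y else 0) - monomials R n {i} * pderiv R n j y := by
  rw [monomials_singleton, pderiv_ι_mul]
  congr 1
  by_cases h : i = j
  · subst h; simp
  · rw [Pi.single_eq_of_ne (Ne.symm h), zero_smul, if_neg h]

theorem pderiv_monomials_of_notMem {i : Fin n} {a : Finset (Fin n)} (h : i ∉ a) :
    pderiv R n i (monomials R n a) = 0 := by
  induction a using Finset.induction_on with
  | empty => rw [monomials_empty]; exact CliffordAlgebra.contractLeft_one (Q := 0) _
  | insert j a hj ih =>
    rw [Finset.mem_insert, not_or] at h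
    obtain ⟨z, hz⟩ := monomials_eq_singleton_mul (R := R) (Finset.mem_insert_self j a)
    rw [hz, Finset.erase_insert hj, Units.smul_def, map_zsmul, pderiv_singleton_mul, ih h.2,
      if_neg (Ne.symm h.1)]
    simp

/-- A single sign serves both formulas, so identities such as H_i ξ^a = ξ^a follow without computing
it. -/
theorem exists_pderiv_monomials {i : Fin n} {a : Finset (Fin n)} (h : i ∈ a) :
    ∃ z : ℤˣ, monomials R n a = z • (monomials R n {i} * monomials R n (a.erase i)) ∧
      pderiv R n i (monomials R n a) = z • monomials R n (a.erase i) := by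
  obtain ⟨z, hz⟩ := monomials_eq_singleton_mul (R := R) h
  refine ⟨z, hz, ?_⟩
  rw [hz, Units.smul_def, map_zsmul, pderiv_singleton_mul, if_pos rfl,
    pderiv_monomials_of_notMem (Finset.notMem_erase i a), mul_zero, sub_zero, Units.smul_def]

theorem chevalleyVec_apply (a : Finset (Fin n)) (i : Fin n) (x : Grassmann R n) :
    (chevalleyVec R a i : Module.End R (Grassmann R n)) x = monomials R n a * pderiv R n i x := rfl

theorem chevalleyVec_singleton_monomials (i : Fin n) (a : Finset (Fin n)) :
    (chevalleyVec R {i} i : Module.End R (Grassmann R n)) (monomials R n a) =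
      if i ∈ a then monomials R n a else 0 := by
  rw [chevalleyVec_apply]
  split_ifs with h
  · obtain ⟨z, h1, h2⟩ := exists_pderiv_monomials (R := R) h
    rw [h2, mul_smul_comm, ← h1]
  · rw [pderiv_monomials_of_notMem h, mul_zero]

theorem chevalleyVec_apply_singleton (a : Finset (Fin n)) (i j : Fin n) :
    (chevalleyVec R a i : Module.End R (Grassmann R n)) (monomials R n {j}) =
      if j = i then monomials R n a else 0 := by
  rw [chevalleyVec_apply]
  split_ifs with h
  · subst h
    rw [← mul_one (monomials R n {j}), pderiv_singleton_mul, if_pos rfl, ← monomials_empty,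
      pderiv_monomials_of_notMem (Finset.notMem_empty j), mul_zero, sub_zero, monomials_empty,
      mul_one]
  · rw [pderiv_monomials_of_notMem (by simpa using Ne.symm h), mul_zero]

theorem chevalleyVec_one (a : Finset (Fin n)) (i : Fin n) :
    (chevalleyVec R a i : Module.End R (Grassmann R n)) 1 = 0 := by
  rw [chevalleyVec_apply, ← monomials_empty, pderiv_monomials_of_notMem (Finset.notMem_empty i),
    mul_zero]

/-- Since ∂_i² = 0, the Leibniz rule leaves ξ^a (∂_i ξ^a) ∂_i. If i ∉ a the middle factor vanishes;
if i ∈ a it is ± ξ^(a∖{i}), which shares a variable with ξ^a unless a = {i}. The excluded case is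
the toral element H_i, which is idempotent. -/
theorem chevalleyVec_sq {a : Finset (Fin n)} {i : Fin n} (h : a ≠ {i}) (x : Grassmann R n) :
    (chevalleyVec R a i : Module.End R (Grassmann R n))
      ((chevalleyVec R a i : Module.End R (Grassmann R n)) x) = 0 := by
  simp only [chevalleyVec_apply]
  have h0 : pderiv R n i (pderiv R n i x) = 0 := CliffordAlgebra.contractLeft_contractLeft _ _
  rw [pderiv_leibniz, h0, mul_zero, add_zero, ← mul_assoc]
  by_cases hi : i ∈ a
  · obtain ⟨z, h1, h2⟩ := exists_pderiv_monomials (R := R) hi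
    rw [h2, mul_smul_comm, monomials_mul_of_not_disjoint, smul_zero, zero_mul]
    obtain ⟨j, hj⟩ : (a.erase i).Nonempty := by
      rw [Finset.nonempty_iff_ne_empty, Ne, Finset.erase_eq_empty_iff]
      rintro (rfl | h')
      · simp at hi
      · exact h h'
    exact Finset.not_disjoint_iff.2 ⟨j, Finset.mem_of_mem_erase hj, hj⟩
  · rw [pderiv_monomials_of_notMem hi, mul_zero, zero_mul]

theorem monomials_mem_lattice (a : Finset (Fin n)) : monomials R n a ∈ lattice R n :=
  Submodule.subset_span (s := Set.range (monomials R n)) ⟨a, rfl⟩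

theorem chevalleyVec_mem_lattice (a : Finset (Fin n)) (i : Fin n) {x : Grassmann R n}
    (hx : x ∈ lattice R n) :
    (chevalleyVec R a i : Module.End R (Grassmann R n)) x ∈ lattice R n := by
  refine Submodule.span_induction (p := fun x _ =>
    (chevalleyVec R a i : Module.End R (Grassmann R n)) x ∈ lattice R n) ?_ ?_ ?_ ?_ hx
  · rintro _ ⟨b, rfl⟩
    rw [chevalleyVec_apply]
    refine mul_mem (monomials_mem_lattice a) ?_
    by_cases hi : i ∈ b
    · obtain ⟨z, -, h2⟩ := exists_pderiv_monomials (R := R) hi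
      rw [h2]
      exact Subalgebra.smul_mem _ (monomials_mem_lattice _) (z : ℤ)
    · rw [pderiv_monomials_of_notMem hi]
      exact zero_mem _
  · rw [map_zero]; exact zero_mem _
  · intro x y _ _ h1 h2; rw [map_add]; exact add_mem h1 h2
  · intro r x _ h; rw [map_zsmul]; exact Subalgebra.smul_mem _ h r

variable (R) in
/-- The operator `ξ^a ∂_i` on the lattice. -/
def latticeVec (a : Finset (Fin n)) (i : Fin n) : lattice R n →+ lattice R n where
  toFun m := ⟨_, chevalleyVec_mem_lattice a i m.2⟩
  map_zero' := Subtype.ext (map_zero _)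
  map_add' _ _ := Subtype.ext (map_add _ _ _)

variable (R) in
/-- The monomial `ξ^a` as an element of the lattice. -/
def mon (a : Finset (Fin n)) : lattice R n := ⟨monomials R n a, monomials_mem_lattice a⟩

theorem latticeVec_coe (a : Finset (Fin n)) (i : Fin n) (m : lattice R n) :
    (latticeVec R a i m : Grassmann R n) =
      (chevalleyVec R a i : Module.End R (Grassmann R n)) m := rfl

theorem mon_coe (a : Finset (Fin n)) : (mon R a : Grassmann R n) = monomials R n a := rfl

theorem mon_mem (a : Finset (Fin n)) : mon R a ∈ latticeGrading R n (a.card : ZMod 2) :=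
  monomials_mem a

theorem mon_empty : mon R (∅ : Finset (Fin n)) = 1 := Subtype.ext monomials_empty

theorem mon_mul_of_disjoint {a b : Finset (Fin n)} (h : Disjoint a b) :
    ∃ z : ℤˣ, mon R a * mon R b = (z : ℤ) • mon R (a ∪ b) := by
  obtain ⟨z, hz⟩ := monomials_mul_of_disjoint (R := R) h
  exact ⟨z, Subtype.ext hz⟩

theorem mon_mul_of_not_disjoint {a b : Finset (Fin n)} (h : ¬Disjoint a b) :
    mon R a * mon R b = 0 := Subtype.ext (monomials_mul_of_not_disjoint h)

theorem mon_eq_singleton_mul {i : Fin n} {a : Finset (Fin n)} (h : i ∈ a) :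
    ∃ z : ℤˣ, mon R a = (z : ℤ) • (mon R {i} * mon R (a.erase i)) := by
  obtain ⟨z, hz⟩ := monomials_eq_singleton_mul (R := R) h
  exact ⟨z, Subtype.ext hz⟩

theorem latticeVec_singleton (a : Finset (Fin n)) (i j : Fin n) :
    latticeVec R a i (mon R {j}) = if j = i then mon R a else 0 := by
  refine Subtype.ext ((chevalleyVec_apply_singleton a i j).trans ?_)
  split_ifs <;> rfl

theorem latticeVec_one (a : Finset (Fin n)) (i : Fin n) : latticeVec R a i 1 = 0 :=
  Subtype.ext (chevalleyVec_one a i)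

theorem latticeVec_sq {a : Finset (Fin n)} {i : Fin n} (h : a ≠ {i}) (m : lattice R n) :
    latticeVec R a i (latticeVec R a i m) = 0 := Subtype.ext (chevalleyVec_sq h _)

theorem latticeVec_mem (a : Finset (Fin n)) (i : Fin n) {j : ZMod 2} {m : lattice R n}
    (hm : m ∈ latticeGrading R n j) :
    latticeVec R a i m ∈ latticeGrading R n (j + ((a.card : ZMod 2) + 1)) :=
  (isSuperDerivation_mul_pderiv (R := R) a i).map_mem j m.1 hm

theorem latticeVec_mul (a : Finset (Fin n)) (i : Fin n) {j : ZMod 2} {m : lattice R n}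
    (hm : m ∈ latticeGrading R n j) (m' : lattice R n) :
    latticeVec R a i (m * m') = latticeVec R a i m * m' +
      (-1) ^ (((a.card : ZMod 2) + 1).val * j.val) * (m * latticeVec R a i m') :=
  Subtype.ext (((isSuperDerivation_mul_pderiv (R := R) a i).leibniz j m.1 m'.1 hm).trans (by simp; rfl))

/-- In characteristic zero the monomials form a `ℤ`-basis of the lattice. -/
def latticeBasis (R : Type w) [CommRing R] [CharZero R] [IsDomain R] (n : ℕ) :
    Module.Basis (Finset (Fin n)) ℤ (lattice R n) :=
  Module.Basis.mk (v := mon R)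
    (LinearIndependent.of_comp (lattice R n).val.toLinearMap
      ((monomials R n).linearIndependent.restrict_scalars (R := ℤ)
        (by simpa using Int.cast_injective)))
    (by
      rintro ⟨x, hx⟩ _
      refine Submodule.span_induction (p := fun x hx =>
        (⟨x, hx⟩ : lattice R n) ∈ Submodule.span ℤ (Set.range (mon R))) ?_ ?_ ?_ ?_ hx
      · rintro _ ⟨a, rfl⟩; exact Submodule.subset_span ⟨a, rfl⟩
      · exact zero_mem _
      · intro x y hx hy h1 h2; exact add_mem h1 h2
      · intro r x hx h; exact Submodule.smul_mem _ r h)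

theorem latticeBasis_apply [CharZero R] [IsDomain R] (a : Finset (Fin n)) :
    latticeBasis R n a = mon R a := Module.Basis.mk_apply _ _ _

theorem involute_monomials (a : Finset (Fin n)) :
    CliffordAlgebra.involute (monomials R n a) = (-1 : R) ^ a.card • monomials R n a := by
  rw [involute_eq (monomials_mem a)]
  rcases Nat.even_or_odd a.card with h | h
  · rw [(ZMod.natCast_eq_zero_iff_even).2 h, h.neg_one_pow]; simp
  · rw [(ZMod.natCast_eq_one_iff_odd).2 h, h.neg_one_pow]; simp [ZMod.val_one]

/-- The grade involution multiplies ξ^a by (-1)^|a| and x by (-1)^j. When the parities differ, the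
coefficient equals its own negative, hence is 0 in characteristic zero. -/
theorem repr_monomials_eq_zero [CharZero R] [IsDomain R] {j : ZMod 2} {x : Grassmann R n}
    (hx : x ∈ grading R n j) {a : Finset (Fin n)} (ha : (a.card : ZMod 2) ≠ j) :
    (monomials R n).repr x a = 0 := by
  have h1 : (monomials R n).coord a ∘ₗ (CliffordAlgebra.involute (Q := 0)).toLinearMap =
      (-1 : R) ^ a.card • (monomials R n).coord a := by
    refine (monomials R n).ext fun b => ?_
    have := involute_monomials (R := R) b
    simp only [LinearMap.comp_apply, AlgHom.toLinearMap_apply, LinearMap.smul_apply]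
    rw [this, map_smul]
    by_cases h : b = a
    · rw [h]
    · simp [Module.Basis.coord_apply, h]
  have h2 := LinearMap.congr_fun h1 x
  simp only [LinearMap.comp_apply, AlgHom.toLinearMap_apply, LinearMap.smul_apply,
    Module.Basis.coord_apply, involute_eq hx] at h2
  have hz : ∀ p : ZMod 2, p = 0 ∨ p = 1 := by decide
  rcases hz j with rfl | rfl
  · have := (ZMod.natCast_ne_zero_iff_odd).1 ha
    rw [this.neg_one_pow] at h2
    simpa [self_eq_neg] using h2
  · have : Even a.card := by
      rcases hz a.card with h | h
      · exact (ZMod.natCast_eq_zero_iff_even).1 h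
      · exact absurd h ha
    rw [this.neg_one_pow] at h2
    simpa [ZMod.val_one, neg_eq_self] using h2

/-- This transfers statements about coefficients from the Grassmann algebra over the field to the
integer coefficients of lattice elements, and so to `V` over an arbitrary A. -/
theorem latticeBasis_repr [CharZero R] [IsDomain R] (m : lattice R n) (a : Finset (Fin n)) :
    (((latticeBasis R n).repr m a : ℤ) : R) = (monomials R n).repr (m : Grassmann R n) a := by
  have h : ((Algebra.linearMap ℤ R) ∘ₗ (latticeBasis R n).coord a) =
      (((monomials R n).coord a).restrictScalars ℤ) ∘ₗ (lattice R n).val.toLinearMap := by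
    refine (latticeBasis R n).ext fun b => ?_
    have h1 : (lattice R n).val.toLinearMap (latticeBasis R n b) = monomials R n b := by
      rw [latticeBasis_apply]; rfl
    rw [LinearMap.comp_apply, LinearMap.comp_apply, h1, LinearMap.restrictScalars_apply,
      Module.Basis.coord_apply, Module.Basis.coord_apply, Module.Basis.repr_self,
      Module.Basis.repr_self, Finsupp.single_apply, Finsupp.single_apply]
    split_ifs <;> simp
  exact LinearMap.congr_fun h m

theorem latticeBasis_repr_eq_zero [CharZero R] [IsDomain R] {j : ZMod 2} {m : lattice R n}
    (hm : m ∈ latticeGrading R n j) {a : Finset (Fin n)} (ha : (a.card : ZMod 2) ≠ j) :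
    (latticeBasis R n).repr m a = 0 := by
  have h := latticeBasis_repr m a
  rw [repr_monomials_eq_zero (x := (m : Grassmann R n)) hm ha] at h
  exact Int.cast_eq_zero.1 h

end Grassmann

/-! ### Coordinates and the degree filtration on V_A -/

namespace CommSuperAlg
namespace V

open Grassmann (mon latticeBasis latticeBasis_apply)

variable {k : Type u} [CommRing k] {𝕂 : Type w} [Field 𝕂] {n : ℕ} {A B : CommSuperAlg.{u, v} k}

/-- The monomial `ξ^a` of `V_A`. -/
def vmon (𝕂 : Type w) [Field 𝕂] (A : CommSuperAlg.{u, v} k) (a : Finset (Fin n)) : V 𝕂 n A :=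
  tmul 1 (mon 𝕂 a)

theorem vmon_empty : vmon 𝕂 A (∅ : Finset (Fin n)) = 1 := by
  rw [vmon, Grassmann.mon_empty, one_eq]

theorem vmon_mem (a : Finset (Fin n)) : vmon 𝕂 A a ∈ grading 𝕂 n A (a.card : ZMod 2) :=
  one_tmul_mem (Grassmann.mon_mem a)

theorem tmul_zsmul (b : A) (z : ℤ) (m : Grassmann.lattice 𝕂 n) :
    tmul b (z • m) = z • tmul b m :=
  map_zsmul (AddMonoidHom.mk' (tmul (𝕂 := 𝕂) (n := n) b) (tmul_add b)) z m

theorem tmul_zero (b : A) : tmul b (0 : Grassmann.lattice 𝕂 n) = 0 :=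
  map_zero (AddMonoidHom.mk' (tmul (𝕂 := 𝕂) (n := n) b) (tmul_add b))

theorem tmul_neg (b : A) (m : Grassmann.lattice 𝕂 n) : tmul b (-m) = -tmul b m :=
  map_neg (AddMonoidHom.mk' (tmul (𝕂 := 𝕂) (n := n) b) (tmul_add b)) m

theorem zsmul_tmul (b : A) (z : ℤ) (m : Grassmann.lattice 𝕂 n) :
    tmul (z • b) m = z • tmul b m :=
  map_zsmul (AddMonoidHom.mk' (fun c : A => tmul (𝕂 := 𝕂) (n := n) c m)
    fun c d => add_tmul c d m) z b

theorem tmul_sum {ι : Type*} (b : A) (s : Finset ι) (f : ι → Grassmann.lattice 𝕂 n) :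
    tmul b (∑ i ∈ s, f i) = ∑ i ∈ s, tmul b (f i) :=
  map_sum (AddMonoidHom.mk' (tmul (𝕂 := 𝕂) (n := n) b) (tmul_add b)) f s

theorem vmon_mul_of_disjoint {a b : Finset (Fin n)} (h : Disjoint a b) :
    ∃ z : ℤˣ, vmon 𝕂 A a * vmon 𝕂 A b = (z : ℤ) • vmon 𝕂 A (a ∪ b) := by
  obtain ⟨z, hz⟩ := Grassmann.mon_mul_of_disjoint (R := 𝕂) h
  exact ⟨z, by rw [vmon, vmon, one_tmul_mul, hz, tmul_zsmul, vmon]⟩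

theorem vmon_mul_of_not_disjoint {a b : Finset (Fin n)} (h : ¬Disjoint a b) :
    vmon 𝕂 A a * vmon 𝕂 A b = 0 := by
  rw [vmon, vmon, one_tmul_mul, Grassmann.mon_mul_of_not_disjoint h, tmul_zero]

theorem vmon_eq_singleton_mul {i : Fin n} {a : Finset (Fin n)} (h : i ∈ a) :
    ∃ z : ℤˣ, vmon 𝕂 A a = (z : ℤ) • (vmon 𝕂 A {i} * vmon 𝕂 A (a.erase i)) := by
  obtain ⟨z, hz⟩ := Grassmann.mon_eq_singleton_mul (R := 𝕂) h
  exact ⟨z, by rw [vmon, vmon, vmon, one_tmul_mul, hz, tmul_zsmul]⟩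

theorem mapAdd_vmon (φ : A ⟶ B) (a : Finset (Fin n)) :
    mapAdd 𝕂 n φ (vmon 𝕂 A a) = vmon 𝕂 B a := by
  rw [vmon, mapAdd_tmul, map_one, vmon]

variable [CharZero 𝕂]

/-- The coefficient of `ξ^a` in an element of `V_A`. -/
def coord (a : Finset (Fin n)) : V 𝕂 n A →ₗ[A] A where
  toFun := (TensorProduct.lift ((LinearMap.lsmul ℤ A).flip.compl₂
    ((latticeBasis 𝕂 n).coord a)) : A ⊗[ℤ] Grassmann.lattice 𝕂 n →ₗ[ℤ] A)
  map_add' := map_add (TensorProduct.lift ((LinearMap.lsmul ℤ A).flip.compl₂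
    ((latticeBasis 𝕂 n).coord a)) : A ⊗[ℤ] Grassmann.lattice 𝕂 n →ₗ[ℤ] A)
  map_smul' b x := by
    rw [RingHom.id_apply]
    induction x using induction_on with
    | h0 => rw [smul_zero]; exact (map_zero _).trans ((congrArg _ (map_zero _)).trans (smul_zero b)).symm
    | ht c m =>
      rw [smul_tmul]
      exact (mul_smul_comm ((latticeBasis 𝕂 n).coord a m) b c).symm
    | ha x y h1 h2 =>
      rw [smul_add]
      refine (map_add _ _ _).trans ((congrArg₂ _ h1 h2).trans ?_)
      rw [← smul_add]
      exact congrArg _ (map_add _ _ _).symm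

theorem coord_tmul (a : Finset (Fin n)) (b : A) (m : Grassmann.lattice 𝕂 n) :
    coord a (tmul b m) = (latticeBasis 𝕂 n).repr m a • b := rfl

theorem coord_vmon (a b : Finset (Fin n)) :
    coord a (vmon 𝕂 A b) = if b = a then 1 else 0 := by
  rw [vmon, coord_tmul, ← latticeBasis_apply, Module.Basis.repr_self, Finsupp.single_apply]
  split_ifs <;> simp

/-- With `coord_vmon`, this says that V_A is free over A on the monomials ξ^a, whatever the
characteristic of A. -/
theorem sum_coord_smul_vmon (x : V 𝕂 n A) : ∑ a, coord a x • vmon 𝕂 A a = x := by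
  induction x using induction_on with
  | h0 => simp
  | ht b m =>
    conv_rhs => rw [← (latticeBasis 𝕂 n).sum_repr m, tmul_sum]
    refine Finset.sum_congr rfl fun a _ => ?_
    rw [coord_tmul, latticeBasis_apply, tmul_zsmul, vmon, smul_tmul, mul_one, zsmul_tmul]
  | ha x y h1 h2 =>
    simp only [map_add, add_smul, Finset.sum_add_distrib]
    rw [h1, h2]

theorem ext_coord {x y : V 𝕂 n A} (h : ∀ a, coord a x = coord a y) : x = y := by
  rw [← sum_coord_smul_vmon x, ← sum_coord_smul_vmon y]
  simp only [h]

theorem coord_mapAdd (φ : A ⟶ B) (a : Finset (Fin n)) (x : V 𝕂 n A) :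
    coord a (mapAdd 𝕂 n φ x) = homAlg φ (coord a x) := by
  induction x using induction_on with
  | h0 => simp
  | ht b m => rw [mapAdd_tmul, coord_tmul, coord_tmul, map_zsmul]
  | ha x y h1 h2 => simp only [map_add, h1, h2]

theorem coord_mem {p : ZMod 2} {x : V 𝕂 n A} (hx : x ∈ grading 𝕂 n A p) (a : Finset (Fin n)) :
    coord a x ∈ A.grading ((a.card : ZMod 2) + p) := by
  induction hx using AddSubgroup.closure_induction with
  | mem x hx =>
    obtain ⟨i, j, b, m, hb, hm, rfl, rfl⟩ := hx
    rw [coord_tmul]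
    by_cases ha : (a.card : ZMod 2) = j
    · rw [ha, ← add_assoc, add_right_comm, CharTwo.add_self_eq_zero, zero_add]
      exact zsmul_mem hb _
    · rw [Grassmann.latticeBasis_repr_eq_zero hm ha, zero_smul]
      exact zero_mem _
  | zero => rw [map_zero]; exact zero_mem _
  | add x y _ _ h1 h2 => rw [map_add]; exact add_mem h1 h2
  | neg x _ h => rw [map_neg]; exact neg_mem h

theorem linearMap_ext_vmon {f g : V 𝕂 n A →ₗ[A] V 𝕂 n A}
    (h : ∀ a, f (vmon 𝕂 A a) = g (vmon 𝕂 A a)) : f = g := by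
  ext x
  rw [← sum_coord_smul_vmon x]
  simp only [map_sum, map_smul, h]

/-- A parity preserving linear map that is multiplicative on monomials is multiplicative. -/
theorem map_mul_of_vmon {g : V 𝕂 n A →ₗ[A] V 𝕂 n A}
    (hg : ∀ p x, x ∈ grading 𝕂 n A p → g x ∈ grading 𝕂 n A p)
    (h : ∀ a b, g (vmon 𝕂 A a * vmon 𝕂 A b) = g (vmon 𝕂 A a) * g (vmon 𝕂 A b))
    (x y : V 𝕂 n A) : g (x * y) = g x * g y := by
  have h1 : ∀ a b (c : A), g (vmon 𝕂 A a * (c • vmon 𝕂 A b)) =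
      g (vmon 𝕂 A a) * g (c • vmon 𝕂 A b) := by
    intro a b c
    -- A homogeneous scalar passes ξ^a with a sign depending only on parities; since g preserves
    -- parity, the same sign appears after applying g.
    have key : ∀ (i : ZMod 2) (c : A), c ∈ A.grading i → g (vmon 𝕂 A a * (c • vmon 𝕂 A b)) =
        g (vmon 𝕂 A a) * g (c • vmon 𝕂 A b) := by
      intro i c hc
      rw [mul_smul_of_mem hc (vmon_mem a), map_smul g c, mul_smul_of_mem hc (hg _ _ (vmon_mem a)),
        Units.smul_def, map_zsmul, Units.smul_def, map_smul, h]
    obtain ⟨c, hc, d, hd, rfl⟩ := exists_even_add_odd A.grading c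
    rw [add_smul, mul_add, map_add, map_add, mul_add, key _ _ hc, key _ _ hd]
  rw [← sum_coord_smul_vmon x, ← sum_coord_smul_vmon y]
  simp only [Finset.sum_mul, map_sum, smul_mul, map_smul g (coord _ x)]
  simp only [Finset.mul_sum, map_sum, h1]

/-- The elements of `V_A` of degree at least `d` in the `ξ_i`. -/
def filt (𝕂 : Type w) [Field 𝕂] [CharZero 𝕂] (n : ℕ) (A : CommSuperAlg.{u, v} k) (d : ℕ) :
    Submodule A (V 𝕂 n A) where
  carrier := {x | ∀ a, a.card < d → coord a x = 0}
  zero_mem' _ _ := map_zero _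
  add_mem' hx hy a ha := by rw [map_add, hx a ha, hy a ha, add_zero]
  smul_mem' c x hx a ha := by rw [map_smul, hx a ha, smul_zero]

theorem vmon_mem_filt {d : ℕ} {a : Finset (Fin n)} (h : d ≤ a.card) :
    vmon 𝕂 A a ∈ filt 𝕂 n A d := by
  intro b hb
  rw [coord_vmon, if_neg]
  rintro rfl
  omega

theorem filt_anti {d e : ℕ} (h : d ≤ e) : filt 𝕂 n A e ≤ filt 𝕂 n A d :=
  fun _ hx a ha => hx a (ha.trans_le h)

/-- A submodule that contains the monomials of degree at least `d` contains `filt d`. -/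
theorem mem_of_mem_filt {d : ℕ} {x : V 𝕂 n A} (hx : x ∈ filt 𝕂 n A d) {S : Submodule A (V 𝕂 n A)}
    (h : ∀ a : Finset (Fin n), d ≤ a.card → vmon 𝕂 A a ∈ S) : x ∈ S := by
  rw [← sum_coord_smul_vmon x]
  refine sum_mem fun a _ => ?_
  by_cases ha : a.card < d
  · rw [hx a ha, zero_smul]; exact zero_mem _
  · exact S.smul_mem _ (h a (not_lt.1 ha))

theorem mul_mem_filt {d e : ℕ} {x y : V 𝕂 n A} (hx : x ∈ filt 𝕂 n A d) (hy : y ∈ filt 𝕂 n A e) :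
    x * y ∈ filt 𝕂 n A (d + e) := by
  have h1 : ∀ (a b : Finset (Fin n)), d ≤ a.card → e ≤ b.card →
      vmon 𝕂 A a * vmon 𝕂 A b ∈ filt 𝕂 n A (d + e) := by
    intro a b ha hb
    by_cases h : Disjoint a b
    · obtain ⟨z, hz⟩ := vmon_mul_of_disjoint (𝕂 := 𝕂) (A := A) h
      rw [hz]
      refine zsmul_mem (vmon_mem_filt ?_) _
      rw [Finset.card_union_of_disjoint h]; omega
    · rw [vmon_mul_of_not_disjoint h]; exact zero_mem _
  -- The scalar in front of the right factor has to be moved past ξ^a, and only its homogeneous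
  -- parts commute with ξ^a up to sign.
  have h2 : ∀ (a b : Finset (Fin n)) (c : A), d ≤ a.card → e ≤ b.card →
      vmon 𝕂 A a * (c • vmon 𝕂 A b) ∈ filt 𝕂 n A (d + e) := by
    intro a b c ha hb
    obtain ⟨c, hc, c', hc', rfl⟩ := exists_even_add_odd A.grading c
    rw [add_smul, mul_add, mul_smul_of_mem hc (vmon_mem a), mul_smul_of_mem hc' (vmon_mem a)]
    exact add_mem (zsmul_mem (Submodule.smul_mem _ _ (h1 a b ha hb)) _)
      (zsmul_mem (Submodule.smul_mem _ _ (h1 a b ha hb)) _)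
  rw [← sum_coord_smul_vmon x, Finset.sum_mul]
  refine sum_mem fun a _ => ?_
  rw [smul_mul]
  by_cases ha : a.card < d
  · rw [hx a ha, zero_smul]; exact zero_mem _
  refine Submodule.smul_mem _ _ ?_
  rw [← sum_coord_smul_vmon y, Finset.mul_sum]
  refine sum_mem fun b _ => ?_
  by_cases hb : b.card < e
  · rw [hy b hb, zero_smul, mul_zero]; exact zero_mem _
  exact h2 a b _ (not_lt.1 ha) (not_lt.1 hb)

theorem map_vmon_mem_filt {g : V 𝕂 n A →ₗ[A] V 𝕂 n A} (h1 : g 1 = 1)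
    (hm : ∀ x y, g (x * y) = g x * g y)
    (h : ∀ i, g (vmon 𝕂 A {i}) ∈ filt 𝕂 n A 1) (a : Finset (Fin n)) :
    g (vmon 𝕂 A a) ∈ filt 𝕂 n A a.card := by
  induction a using Finset.induction_on with
  | empty => rw [vmon_empty, h1, ← vmon_empty]; exact vmon_mem_filt le_rfl
  | insert i a hi ih =>
    obtain ⟨z, hz⟩ := vmon_eq_singleton_mul (𝕂 := 𝕂) (A := A) (Finset.mem_insert_self i a)
    rw [Finset.erase_insert hi] at hz
    rw [hz, map_zsmul, hm, Finset.card_insert_of_notMem hi, add_comm]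
    exact zsmul_mem (mul_mem_filt (h i) ih) _

theorem map_mem_filt {g : V 𝕂 n A →ₗ[A] V 𝕂 n A} (h1 : g 1 = 1)
    (hm : ∀ x y, g (x * y) = g x * g y)
    (h : ∀ i, g (vmon 𝕂 A {i}) ∈ filt 𝕂 n A 1) {d : ℕ} {x : V 𝕂 n A}
    (hx : x ∈ filt 𝕂 n A d) : g x ∈ filt 𝕂 n A d :=
  mem_of_mem_filt (S := (filt 𝕂 n A d).comap g) hx fun a ha =>
    filt_anti ha (map_vmon_mem_filt h1 hm h a)

/-- An automorphism that is the identity on generators modulo degree 2 acts trivially on the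
associated graded algebra. The induction splits g(ξ_i) g(ξ^a) - ξ_i ξ^a as (g(ξ_i) - ξ_i) g(ξ^a) +
ξ_i (g(ξ^a) - ξ^a), and each summand gains one degree. -/
theorem map_vmon_sub_mem_filt {g : V 𝕂 n A →ₗ[A] V 𝕂 n A} (h1 : g 1 = 1)
    (hm : ∀ x y, g (x * y) = g x * g y)
    (h : ∀ i, g (vmon 𝕂 A {i}) - vmon 𝕂 A {i} ∈ filt 𝕂 n A 2)
    (a : Finset (Fin n)) : g (vmon 𝕂 A a) - vmon 𝕂 A a ∈ filt 𝕂 n A (a.card + 1) := by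
  have h' : ∀ i, g (vmon 𝕂 A {i}) ∈ filt 𝕂 n A 1 := fun i => by
    have := add_mem (filt_anti one_le_two (h i)) (vmon_mem_filt (𝕂 := 𝕂) (A := A) (a := {i}) le_rfl)
    rwa [sub_add_cancel] at this
  induction a using Finset.induction_on with
  | empty => rw [vmon_empty, h1, sub_self]; exact zero_mem _
  | insert i a hi ih =>
    obtain ⟨z, hz⟩ := vmon_eq_singleton_mul (𝕂 := 𝕂) (A := A) (Finset.mem_insert_self i a)
    rw [Finset.erase_insert hi] at hz
    rw [hz, map_zsmul, hm, ← smul_sub, Finset.card_insert_of_notMem hi]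
    have e : g (vmon 𝕂 A {i}) * g (vmon 𝕂 A a) - vmon 𝕂 A {i} * vmon 𝕂 A a =
        (g (vmon 𝕂 A {i}) - vmon 𝕂 A {i}) * g (vmon 𝕂 A a) +
          vmon 𝕂 A {i} * (g (vmon 𝕂 A a) - vmon 𝕂 A a) := by
      rw [sub_mul, mul_sub]; abel
    rw [e]
    refine zsmul_mem (add_mem ?_ ?_) _
    · have := mul_mem_filt (h i) (map_vmon_mem_filt h1 hm h' a)
      exact filt_anti (by omega) this
    · have := mul_mem_filt (vmon_mem_filt (𝕂 := 𝕂) (A := A) (a := {i}) le_rfl) ih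
      exact filt_anti (by rw [Finset.card_singleton]; omega) this

theorem eq_id_of_vmon_singleton {g : V 𝕂 n A →ₗ[A] V 𝕂 n A} (h1 : g 1 = 1)
    (hm : ∀ x y, g (x * y) = g x * g y)
    (h : ∀ i, g (vmon 𝕂 A {i}) = vmon 𝕂 A {i}) :
    g = LinearMap.id := by
  refine linearMap_ext_vmon fun a => ?_
  rw [LinearMap.id_apply]
  induction a using Finset.induction_on with
  | empty => rw [vmon_empty, h1]
  | insert i a hi ih =>
    obtain ⟨z, hz⟩ := vmon_eq_singleton_mul (𝕂 := 𝕂) (A := A) (Finset.mem_insert_self i a)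
    rw [Finset.erase_insert hi] at hz
    rw [hz, map_zsmul, hm, h, ih]

end V
end CommSuperAlg

/-! ### Root vectors square to zero: products of values, nilpotency class, weights -/

namespace Grassmann

theorem zmod_two_eq_zero_or_one (p : ZMod 2) : p = 0 ∨ p = 1 := by
  revert p; decide

variable {𝕂 : Type w} [Field 𝕂] {n : ℕ}

/-- For an even derivation X with X² = 0, applying X to the Leibniz rule for X(m m') gives 0 = 2
X(m) X(m'). The factor 2 is cancelled over 𝕂, before extension of scalars, since 2 may well be a
zero divisor in A. -/
theorem latticeVec_mul_latticeVec [CharZero 𝕂] {a : Finset (Fin n)} {i : Fin n} (h : a ≠ {i})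
    (ha : (a.card : ZMod 2) + 1 = 0) {j : ZMod 2} {m : lattice 𝕂 n}
    (hm : m ∈ latticeGrading 𝕂 n j) (m' : lattice 𝕂 n) :
    latticeVec 𝕂 a i m * latticeVec 𝕂 a i m' = 0 := by
  have h1 := latticeVec_mul (R := 𝕂) a i hm m'
  have h2 := congrArg (latticeVec 𝕂 a i) h1
  have hm' := latticeVec_mem a i hm
  rw [latticeVec_sq h, ha, ZMod.val_zero, zero_mul, pow_zero, one_mul, map_add,
    latticeVec_mul a i hm', latticeVec_mul a i hm, latticeVec_sq h, latticeVec_sq h, ha] at h2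
  simp only [ZMod.val_zero, zero_mul, pow_zero, one_mul, mul_zero, zero_add, add_zero] at h2
  have h3 : (latticeVec 𝕂 a i m * latticeVec 𝕂 a i m' : Grassmann 𝕂 n) +
      latticeVec 𝕂 a i m * latticeVec 𝕂 a i m' = 0 := (congrArg Subtype.val h2).symm
  rw [← two_smul 𝕂] at h3
  exact Subtype.ext ((smul_eq_zero.1 h3).resolve_left two_ne_zero)

/-- X is nonzero because X ξ_i = ξ^a, and X² = 0. Thus the exponential series in `IsExp` has
precisely the terms r = 0 and r = 1. -/
theorem nilpotencyClass_chevalleyVec {a : Finset (Fin n)} {i : Fin n} (h : a ≠ {i}) :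
    nilpotencyClass (chevalleyVec 𝕂 a i : Module.End 𝕂 (Grassmann 𝕂 n)) = 2 := by
  refine (nilpotencyClass_eq_succ_iff (k := 1)).2 ⟨?_, fun h0 => ?_⟩
  · refine LinearMap.ext fun x => ?_
    rw [pow_two]
    exact chevalleyVec_sq h x
  · have h1 := LinearMap.congr_fun h0 (monomials 𝕂 n {i})
    rw [pow_one, chevalleyVec_apply_singleton, if_pos rfl] at h1
    exact (monomials 𝕂 n).ne_zero a h1

theorem repr_chevalleyVec_singleton (i : Fin n) (x : Grassmann 𝕂 n) (a : Finset (Fin n)) :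
    (monomials 𝕂 n).repr ((chevalleyVec 𝕂 {i} i : Module.End 𝕂 (Grassmann 𝕂 n)) x) a =
      if i ∈ a then (monomials 𝕂 n).repr x a else 0 := by
  have h : (monomials 𝕂 n).coord a ∘ₗ (chevalleyVec 𝕂 {i} i : Module.End 𝕂 (Grassmann 𝕂 n)) =
      (if i ∈ a then (1 : 𝕂) else 0) • (monomials 𝕂 n).coord a := by
    refine (monomials 𝕂 n).ext fun b => ?_
    rw [LinearMap.comp_apply, chevalleyVec_singleton_monomials, LinearMap.smul_apply]
    by_cases hb : b = a
    · subst hb; split_ifs <;> simp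
    · split_ifs <;> simp [hb]
  refine (LinearMap.congr_fun h x).trans ?_
  split_ifs <;> simp

end Grassmann

/-! ### The generators: existence, and why they are superalgebra automorphisms -/

namespace CommSuperAlg
namespace V

open Grassmann (mon latticeBasis latticeBasis_apply latticeVec zmod_two_eq_zero_or_one)

variable {k : Type u} [CommRing k] {𝕂 : Type w} [Field 𝕂] {n : ℕ} {A B : CommSuperAlg.{u, v} k}

theorem mem_grading_extend {f : Grassmann.lattice 𝕂 n →+ V 𝕂 n A}
    (hf : ∀ p m, m ∈ Grassmann.latticeGrading 𝕂 n p → f m ∈ grading 𝕂 n A p)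
    {p : ZMod 2} {x : V 𝕂 n A} (hx : x ∈ grading 𝕂 n A p) : extend f x ∈ grading 𝕂 n A p := by
  induction hx using AddSubgroup.closure_induction with
  | mem x hx =>
    obtain ⟨p, q, b, m, hb, hm, rfl, rfl⟩ := hx
    rw [extend_tmul]
    exact smul_mem hb (hf _ _ hm)
  | zero => rw [map_zero]; exact zero_mem _
  | add x y _ _ h1 h2 => rw [map_add]; exact add_mem h1 h2
  | neg x _ h => rw [map_neg]; exact neg_mem h

/-- The element of `GL(V_A)` given by mutually inverse parity preserving maps on the lattice. -/
theorem exists_superGL (f f' : Grassmann.lattice 𝕂 n →+ V 𝕂 n A)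
    (hf : ∀ p m, m ∈ Grassmann.latticeGrading 𝕂 n p → f m ∈ grading 𝕂 n A p)
    (hf' : ∀ p m, m ∈ Grassmann.latticeGrading 𝕂 n p → f' m ∈ grading 𝕂 n A p)
    (h : ∀ m, extend f (f' m) = tmul 1 m) (h' : ∀ m, extend f' (f m) = tmul 1 m) :
    ∃ g : SuperGL 𝕂 n A, ∀ m, g.1 (tmul 1 m) = f m := by
  have e : ∀ f f' : Grassmann.lattice 𝕂 n →+ V 𝕂 n A, (∀ m, extend f (f' m) = tmul 1 m) →
      extend f ∘ₗ extend f' = LinearMap.id := fun f f' h =>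
    linearMap_ext fun m => by rw [LinearMap.comp_apply, extend_tmul, one_smul, h]; rfl
  refine ⟨⟨LinearEquiv.ofLinearMap (extend f) (extend f') (e _ _ h) (e _ _ h'), fun p x =>
    ⟨fun hx => ?_, fun hx => mem_grading_extend hf hx⟩⟩, fun m => one_smul A (f m)⟩
  have h1 := mem_grading_extend hf' hx
  have h2 : extend f' (extend f x) = x := LinearMap.congr_fun (e _ _ h') x
  exact h2 ▸ h1

theorem isExp_iff [CharZero 𝕂] {a : Finset (Fin n)} {i : Fin n} (h : a ≠ {i}) (t : A)
    (g : V 𝕂 n A ≃ₗ[A] V 𝕂 n A) : IsExp (Grassmann.chevalleyVec 𝕂 a i).1 t g ↔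
      ∀ m, g (tmul 1 m) = tmul 1 m + tmul t (latticeVec 𝕂 a i m) := by
  unfold IsExp
  rw [Grassmann.nilpotencyClass_chevalleyVec h]
  constructor
  · rintro ⟨D, hD, hg⟩ m
    have h0 : D 0 m = m := Subtype.ext ((hD 0 m).trans (by simp))
    have h1 : D 1 m = latticeVec 𝕂 a i m := Subtype.ext ((hD 1 m).trans (by
      rw [Nat.factorial_one, Nat.cast_one, inv_one, one_smul, pow_one]; rfl))
    rw [hg, Finset.sum_range_succ, Finset.sum_range_one, h0, h1, pow_zero, pow_one]
  · intro hg
    -- The divided powers vanish from r = 2 on, so the default value 0 is the forced one.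
    refine ⟨fun r m => if r = 0 then m else if r = 1 then latticeVec 𝕂 a i m else 0, ?_, ?_⟩
    · intro r m
      match r with
      | 0 => simp
      | 1 => simp [Grassmann.latticeVec_coe]
      | r + 2 =>
        have h2 : ((Grassmann.chevalleyVec 𝕂 a i).1 : Module.End 𝕂 (Grassmann 𝕂 n)) ^ 2 = 0 :=
          LinearMap.ext fun x => by rw [pow_two]; exact Grassmann.chevalleyVec_sq h x
        rw [pow_add, h2]
        simp
    · intro m
      rw [hg, Finset.sum_range_succ, Finset.sum_range_one]
      simp

theorem isExp_one [CharZero 𝕂] {a : Finset (Fin n)} {i : Fin n} (h : a ≠ {i}) {t : A}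
    {g : V 𝕂 n A ≃ₗ[A] V 𝕂 n A} (hg : IsExp (Grassmann.chevalleyVec 𝕂 a i).1 t g) : g 1 = 1 := by
  rw [one_eq, (isExp_iff h t g).1 hg, Grassmann.latticeVec_one, tmul_zero, add_zero]

/-- On monomials, (1 + tX)(x) (1 + tX)(y) differs from (1 + tX)(xy) only by tX(x) · tX(y), once
Leibniz signs are matched. This term is zero because t² = 0 when X is odd and X(x) X(y) = 0 when X
is even. -/
theorem isExp_mul [CharZero 𝕂] {a : Finset (Fin n)} {i : Fin n} (h : a ≠ {i}) {t : A}
    (ht : t ∈ A.grading ((a.card : ZMod 2) + 1)) {g : SuperGL 𝕂 n A}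
    (hg : IsExp (Grassmann.chevalleyVec 𝕂 a i).1 t g.1) (x y : V 𝕂 n A) :
    g.1 (x * y) = g.1 x * g.1 y := by
  rw [isExp_iff h] at hg
  refine map_mul_of_vmon (g := g.1.toLinearMap) (fun p x => (g.2 p x).2) (fun b c => ?_) x y
  have hm := Grassmann.mon_mem (R := 𝕂) b
  have h4 : tmul t (latticeVec 𝕂 a i (mon 𝕂 b)) * tmul t (latticeVec 𝕂 a i (mon 𝕂 c)) = 0 := by
    rw [tmul_mul_tmul _ _ _ _ ht (Grassmann.latticeVec_mem a i hm)]
    rcases zmod_two_eq_zero_or_one ((a.card : ZMod 2) + 1) with hp | hp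
    · rw [Grassmann.latticeVec_mul_latticeVec h hp hm, tmul_zero, smul_zero]
    · rw [hp] at ht
      rw [A.odd_sq t ht, zero_tmul, smul_zero]
  show g.1 (tmul 1 _ * tmul 1 _) = g.1 (tmul 1 _) * g.1 (tmul 1 _)
  rw [one_tmul_mul, hg, hg, hg, add_mul, mul_add, mul_add, h4, add_zero, one_tmul_mul,
    tmul_mul_tmul _ _ _ _ ht hm, tmul_mul_tmul _ _ _ _ (SetLike.one_mem_graded A.grading)
      (Grassmann.latticeVec_mem a i hm), Grassmann.latticeVec_mul a i hm, one_mul, mul_one,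
    mul_zero, uzpow_zero, one_smul, add_assoc, tmul_add]
  rw [add_comm (tmul t (latticeVec 𝕂 a i (mon 𝕂 b) * mon 𝕂 c))]
  congr 2
  -- The sign from moving t past ξ^b is to be compared with the Leibniz sign of X past ξ^b; they
  -- agree because t and X have the same parity.
  rcases zmod_two_eq_zero_or_one ((a.card : ZMod 2) + 1) with hp | hp <;>
  rcases zmod_two_eq_zero_or_one ((b.card : ZMod 2)) with hq | hq <;>
  rw [hp, hq] <;> simp [ZMod.val_one, tmul_neg]

/-- The inverse of 1 + tX is 1 - tX, because X² = 0. Both preserve parity since t has the parity of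
X. -/
theorem exists_isExp [CharZero 𝕂] {a : Finset (Fin n)} {i : Fin n} (h : a ≠ {i}) {t : A}
    (ht : t ∈ A.grading ((a.card : ZMod 2) + 1)) :
    ∃ g : SuperGL 𝕂 n A, IsExp (Grassmann.chevalleyVec 𝕂 a i).1 t g.1 := by
  let f : A → Grassmann.lattice 𝕂 n →+ V 𝕂 n A := fun t =>
    AddMonoidHom.mk' (fun m => tmul 1 m + tmul t (latticeVec 𝕂 a i m)) fun m m' => by
      rw [map_add, tmul_add, tmul_add]; abel
  have hf : ∀ t m, f t m = tmul 1 m + tmul t (latticeVec 𝕂 a i m) := fun _ _ => rfl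
  have hmem : ∀ t ∈ A.grading ((a.card : ZMod 2) + 1), ∀ p m,
      m ∈ Grassmann.latticeGrading 𝕂 n p → f t m ∈ grading 𝕂 n A p := by
    intro t ht p m hm
    refine add_mem (one_tmul_mem hm) ?_
    have := tmul_mem ht (Grassmann.latticeVec_mem a i hm)
    rwa [add_left_comm, CharTwo.add_self_eq_zero, add_zero] at this
  have hinv : ∀ t m, extend (f t) (f (-t) m) = tmul 1 m := by
    intro t m
    rw [hf, map_add, extend_tmul, extend_tmul, hf, hf, Grassmann.latticeVec_sq h, tmul_zero,
      add_zero, one_smul, tmul_eq t, tmul_eq (A := A) 1 (latticeVec 𝕂 a i m), one_smul, add_assoc,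
      ← add_smul, add_neg_cancel, zero_smul, add_zero]
  obtain ⟨g, hg⟩ := exists_superGL (f t) (f (-t)) (hmem t ht) (hmem _ (neg_mem ht)) (hinv t)
    (by simpa using hinv (-t))
  exact ⟨g, (isExp_iff h t g.1).2 hg⟩

/-- The eigenvalue of `h_H(u)` on `ξ^a`. -/
def torusChar (z : Fin n → ℤ) (u : A.evenˣ) (a : Finset (Fin n)) : A :=
  ((u ^ (∑ j ∈ a, z j) : A.evenˣ) : A.even)

theorem torusChar_mem (z : Fin n → ℤ) (u : A.evenˣ) (a : Finset (Fin n)) :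
    torusChar z u a ∈ A.grading 0 := Subtype.prop _

theorem torusChar_mul (z : Fin n → ℤ) (u : A.evenˣ) {a b : Finset (Fin n)} (h : Disjoint a b) :
    torusChar z u a * torusChar z u b = torusChar z u (a ∪ b) := by
  unfold torusChar
  rw [Finset.sum_union h, zpow_add]
  rfl

/-- The weight of ξ^a is the indicator function of a. In characteristic zero distinct integral
weights stay distinct in 𝕂, so a lattice vector of weight μ involves only monomials of weight μ, and
the condition on monomials suffices. -/
theorem isTorus_iff [CharZero 𝕂] (z : Fin n → ℤ) (u : A.evenˣ) (g : V 𝕂 n A ≃ₗ[A] V 𝕂 n A) :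
    IsTorus z u g ↔ ∀ a, g (vmon 𝕂 A a) = torusChar z u a • vmon 𝕂 A a := by
  constructor
  · intro h a
    have hw : IsWeightVector (fun j => if j ∈ a then 1 else 0) (mon 𝕂 a : Grassmann 𝕂 n) := by
      intro j
      rw [Grassmann.mon_coe, Grassmann.chevalleyVec_singleton_monomials]
      by_cases hj : j ∈ a <;> simp [hj]
    refine (h _ _ hw).trans ?_
    have e : ∑ j, z j * (if j ∈ a then 1 else 0) = ∑ j ∈ a, z j := by simp
    rw [e, tmul_eq]
    rfl
  · intro h μ m hm
    have key : ∀ a, (latticeBasis 𝕂 n).repr m a ≠ 0 → ∑ j, z j * μ j = ∑ j ∈ a, z j := by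
      intro a ha
      have hj : ∀ j, μ j = if j ∈ a then 1 else 0 := by
        intro j
        -- The coefficient of ξ^a in H_j m = μ_j m reads [j ∈ a] c = μ_j c with c ≠ 0, which
        -- determines μ_j.
        have h1 := congrArg (fun x => (Grassmann.monomials 𝕂 n).repr x a) (hm j)
        simp only [Grassmann.repr_chevalleyVec_singleton, map_smul, Finsupp.smul_apply,
          ← Grassmann.latticeBasis_repr, smul_eq_mul] at h1
        have h2 : ((latticeBasis 𝕂 n).repr m a : 𝕂) ≠ 0 := Int.cast_ne_zero.2 ha
        split_ifs at h1 ⊢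
        · exact_mod_cast (mul_right_cancel₀ h2 ((one_mul _).trans h1)).symm
        · exact_mod_cast (mul_eq_zero.1 h1.symm).resolve_right h2
      simp [hj]
    conv_lhs => rw [← (latticeBasis 𝕂 n).sum_repr m, tmul_sum, map_sum]
    conv_rhs => rw [← (latticeBasis 𝕂 n).sum_repr m, tmul_sum]
    refine Finset.sum_congr rfl fun a _ => ?_
    rw [latticeBasis_apply, tmul_zsmul, map_zsmul, tmul_zsmul, tmul_eq (A := A) (_ : A.even).1]
    by_cases ha : (latticeBasis 𝕂 n).repr m a = 0
    · rw [ha, zero_smul, zero_smul]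
    · rw [key a ha]
      exact congrArg _ (h a)

theorem isTorus_one [CharZero 𝕂] {z : Fin n → ℤ} {u : A.evenˣ} {g : V 𝕂 n A ≃ₗ[A] V 𝕂 n A}
    (hg : IsTorus z u g) : g 1 = 1 := by
  rw [← vmon_empty, (isTorus_iff z u g).1 hg, torusChar, Finset.sum_empty, zpow_zero]
  exact one_smul A _

theorem isTorus_mul [CharZero 𝕂] {z : Fin n → ℤ} {u : A.evenˣ} {g : SuperGL 𝕂 n A}
    (hg : IsTorus z u g.1) (x y : V 𝕂 n A) : g.1 (x * y) = g.1 x * g.1 y := by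
  rw [isTorus_iff] at hg
  refine map_mul_of_vmon (g := g.1.toLinearMap) (fun p x => (g.2 p x).2) (fun b c => ?_) x y
  show g.1 (vmon 𝕂 A b * vmon 𝕂 A c) = g.1 (vmon 𝕂 A b) * g.1 (vmon 𝕂 A c)
  rw [hg, hg, smul_mul, mul_smul_of_mem (torusChar_mem z u c) (vmon_mem b), mul_zero, uzpow_zero,
    one_smul]
  by_cases h : Disjoint b c
  · obtain ⟨s, hs⟩ := vmon_mul_of_disjoint (𝕂 := 𝕂) (A := A) h
    rw [hs, map_zsmul, hg, smul_smul, ← torusChar_mul z u h, smul_comm]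
  · rw [vmon_mul_of_not_disjoint h, map_zero, smul_zero, smul_zero]

/-- The map is diagonal in the monomial basis with eigenvalues `torusChar z u`, and its inverse is
the same construction for u⁻¹. -/
theorem exists_isTorus [CharZero 𝕂] (z : Fin n → ℤ) (u : A.evenˣ) :
    ∃ g : SuperGL 𝕂 n A, IsTorus z u g.1 := by
  let f : A.evenˣ → Grassmann.lattice 𝕂 n →+ V 𝕂 n A := fun u =>
    ∑ a, (smulAddHom A (V 𝕂 n A) (torusChar z u a)).comp
      ((zmultiplesHom _ (vmon 𝕂 A a)).comp ((latticeBasis 𝕂 n).coord a).toAddMonoidHom)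
  have hf : ∀ u m, f u m =
      ∑ a, torusChar z u a • ((latticeBasis 𝕂 n).repr m a • vmon 𝕂 A a) := by
    intro u m
    simp [f]
  have hfmon : ∀ u a, f u (mon 𝕂 a) = torusChar z u a • vmon 𝕂 A a := by
    intro u a
    rw [hf, Finset.sum_eq_single a]
    · rw [← latticeBasis_apply, Module.Basis.repr_self, Finsupp.single_eq_same, one_smul]
    · intro b _ hb
      rw [← latticeBasis_apply, Module.Basis.repr_self, Finsupp.single_eq_of_ne hb, zero_smul,
        smul_zero]
    · simp
  have hmem : ∀ u p m, m ∈ Grassmann.latticeGrading 𝕂 n p → f u m ∈ grading 𝕂 n A p := by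
    intro u p m hm
    rw [hf]
    refine sum_mem fun a _ => ?_
    by_cases ha : (a.card : ZMod 2) = p
    · have := smul_mem (torusChar_mem z u a)
        (zsmul_mem (vmon_mem (𝕂 := 𝕂) (A := A) a) ((latticeBasis 𝕂 n).repr m a))
      rwa [zero_add, ha] at this
    · rw [Grassmann.latticeBasis_repr_eq_zero hm ha, zero_smul, smul_zero]
      exact zero_mem _
  have hinv : ∀ u m, extend (f u) (f u⁻¹ m) = tmul 1 m := by
    intro u m
    have h1 : extend (f u) ∘ₗ extend (f u⁻¹) = LinearMap.id := by
      refine linearMap_ext_vmon fun a => ?_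
      have e : ∀ u, extend (f u) (vmon 𝕂 A a) = torusChar z u a • vmon 𝕂 A a := fun u =>
        (one_smul A _).trans (hfmon u a)
      rw [LinearMap.comp_apply, e, map_smul, e, smul_smul, LinearMap.id_apply]
      have h2 : torusChar z u⁻¹ a * torusChar z u a = 1 := by
        unfold torusChar
        rw [inv_zpow, ← Subalgebra.coe_mul, ← Units.val_mul, inv_mul_cancel]
        rfl
      rw [h2, one_smul]
    refine Eq.trans ?_ (LinearMap.congr_fun h1 (tmul 1 m))
    exact congrArg _ (one_smul A _).symm
  obtain ⟨g, hg⟩ := exists_superGL (f u) (f u⁻¹) (hmem _) (hmem _) (hinv u)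
    (by simpa using hinv u⁻¹)
  exact ⟨g, (isTorus_iff z u g.1).2 fun a => (hg _).trans (hfmon u a)⟩

/-- The group `G_{Λ(n)}(A)`. -/
def elemGroup (𝕂 : Type w) [Field 𝕂] (n : ℕ) (A : CommSuperAlg.{u, v} k) :
    Subgroup (SuperGL 𝕂 n A) := (groupFunctor 𝕂 k n).obj A

/-- The group `Aut(Λ(n))(A)`. -/
def autGroup (𝕂 : Type w) [Field 𝕂] (n : ℕ) (A : CommSuperAlg.{u, v} k) :
    Subgroup (SuperGL 𝕂 n A) := (autFunctor 𝕂 k n).obj A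

variable [CharZero 𝕂]

theorem elemGroup_le_autGroup (A : CommSuperAlg.{u, v} k) :
    elemGroup 𝕂 n A ≤ autGroup 𝕂 n A := by
  refine (Subgroup.closure_le _).2 ?_
  rintro g (⟨z, u, h⟩ | ⟨a, i, t, ha, ht, h⟩)
  · exact ⟨isTorus_one h, isTorus_mul h⟩
  · exact ⟨isExp_one ha h, isExp_mul ha ht h⟩

theorem exists_mem_elemGroup_root {a : Finset (Fin n)} {i : Fin n} (h : a ≠ {i}) {t : A}
    (ht : t ∈ A.grading ((a.card : ZMod 2) + 1)) :
    ∃ g : SuperGL 𝕂 n A, g ∈ elemGroup 𝕂 n A ∧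
      ∀ j, g.1 (vmon 𝕂 A {j}) = vmon 𝕂 A {j} + if j = i then t • vmon 𝕂 A a else 0 := by
  obtain ⟨g, hg⟩ := exists_isExp (𝕂 := 𝕂) h ht
  refine ⟨g, Subgroup.subset_closure (Or.inr ⟨a, i, t, h, ht, hg⟩), fun j => ?_⟩
  rw [vmon, (isExp_iff h t g.1).1 hg, Grassmann.latticeVec_singleton]
  split_ifs
  · rw [tmul_eq t]; rfl
  · rw [tmul_zero]

/-- This is h_H(u) for H = H_i: the weight of ξ_j on H_i is δ_ij. -/
theorem exists_mem_elemGroup_scale (i : Fin n) (u : A.evenˣ) :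
    ∃ g : SuperGL 𝕂 n A, g ∈ elemGroup 𝕂 n A ∧
      ∀ j, g.1 (vmon 𝕂 A {j}) = if j = i then (u : A) • vmon 𝕂 A {j} else vmon 𝕂 A {j} := by
  obtain ⟨g, hg⟩ := exists_isTorus (𝕂 := 𝕂) (A := A) (Pi.single i 1) u
  refine ⟨g, Subgroup.subset_closure (Or.inl ⟨_, u, hg⟩), fun j => ?_⟩
  rw [(isTorus_iff _ u g.1).1 hg, torusChar, Finset.sum_singleton]
  split_ifs with h
  · subst h; simp
  · rw [Pi.single_eq_of_ne h, zpow_zero]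
    exact one_smul A _

end V
end CommSuperAlg

/-! ### Zariski-local arguments -/

namespace CommSuperAlg

variable {k : Type u} [CommRing k]

/-- The annihilator of c in A₀ contains a power of each f in s, so its radical, and hence the
annihilator itself, is the unit ideal. -/
theorem eq_zero_of_toLoc {A : CommSuperAlg.{u, v} k} {s : Set A.even} (hs : Ideal.span s = ⊤)
    {c : A} (h : ∀ f ∈ s, homAlg (A.toLoc f) c = 0) : c = 0 := by
  let I : Ideal A.even := LinearMap.ker (LinearMap.toSpanSingleton A.even A c)
  have hI : Ideal.span s ≤ I.radical := by
    refine Ideal.span_le.2 fun f hf => ?_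
    have h1 : (Loc.mk c 0 : Loc A f) = Loc.mk 0 0 := (h f hf).trans (Loc.zero_eq 0)
    obtain ⟨m, hm⟩ := Loc.mk_eq.1 h1
    refine ⟨m, ?_⟩
    simp only [pow_zero, one_mul, mul_zero] at hm
    exact hm
  rw [hs, top_le_iff, Ideal.radical_eq_top] at hI
  have h1 : (1 : A.even) ∈ I := by rw [hI]; trivial
  have h2 : (1 : A.even) • c = 0 := h1
  rwa [one_smul] at h2

end CommSuperAlg

namespace SubgroupFunctor

open CommSuperAlg

variable {k : Type u} [CommRing k] {F : CommSuperAlg.{u, v} k ⥤ GrpCat.{w}}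

theorem mem_sheafify_iff (G : SubgroupFunctor F) {A : CommSuperAlg.{u, v} k} {g : F.obj A} :
    g ∈ (G.sheafify (zariski k)).obj A ↔ ∃ s : Set A.even, Ideal.span s = ⊤ ∧
      ∀ f ∈ s, (F.map (A.toLoc f)).hom g ∈ G.obj (A.loc f) := Iff.rfl

theorem le_sheafify (G : SubgroupFunctor F) (A : CommSuperAlg.{u, v} k) :
    G.obj A ≤ (G.sheafify (zariski k)).obj A :=
  G.toSubfunctor.le_sheafify (zariski k) (op (op A))

/-- Membership in the sheafification is itself local, by transitivity of the topology. The auxiliary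
sieve `S` consists of the arrows along which the sieve of g pulls back to a covering sieve. -/
theorem mem_sheafify_of_toLoc (G : SubgroupFunctor F) {A : CommSuperAlg.{u, v} k} {g : F.obj A}
    {s : Set A.even} (hs : Ideal.span s = ⊤)
    (h : ∀ f ∈ s, (F.map (A.toLoc f)).hom g ∈ (G.sheafify (zariski k)).obj (A.loc f)) :
    g ∈ (G.sheafify (zariski k)).obj A := by
  let R : Sieve (op A) := G.toSubfunctor.sieveOfSection (U := op (op A)) g
  let S : Sieve (op A) :=
    { arrows := fun Y φ => R.pullback φ ∈ zariski k Y
      downward_closed := fun {Y Z φ} hφ ψ => by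
        rw [Sieve.pullback_comp]
        exact (zariski k).pullback_stable ψ hφ }
  refine (zariski k).transitive (S := S) ⟨s, hs, fun f hf => ?_⟩ R fun Y φ hφ => hφ
  obtain ⟨t, ht, h'⟩ := (G.mem_sheafify_iff).1 (h f hf)
  refine ⟨t, ht, fun f' hf' => ?_⟩
  have h2 := h' f' hf'
  show (F.map (A.toLoc f ≫ (A.loc f).toLoc f')).hom g ∈ G.obj _
  rw [F.map_comp]
  exact h2

end SubgroupFunctor

namespace CommSuperAlg
namespace V

variable {k : Type u} [CommRing k] {𝕂 : Type w} [Field 𝕂] {n : ℕ}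
  {A B : CommSuperAlg.{u, v} k}

theorem SuperGL.map_mapAdd (φ : A ⟶ B) (g : SuperGL 𝕂 n A) (x : V 𝕂 n A) :
    (SuperGL.map φ g).1 (mapAdd 𝕂 n φ x) = mapAdd 𝕂 n φ (g.1 x) :=
  baseChange_mapAdd φ g.1.toLinearMap x

/-- The group `𝐆_{Λ(n)}(A)`. -/
def localGroup (𝕂 : Type w) [Field 𝕂] (n : ℕ) (A : CommSuperAlg.{u, v} k) :
    Subgroup (SuperGL 𝕂 n A) := (supergroup 𝕂 k n).obj A

theorem elemGroup_le_localGroup (A : CommSuperAlg.{u, v} k) :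
    elemGroup 𝕂 n A ≤ localGroup 𝕂 n A := (groupFunctor 𝕂 k n).le_sheafify A

theorem mem_localGroup_of_toLoc {g : SuperGL 𝕂 n A} {s : Set A.even} (hs : Ideal.span s = ⊤)
    (h : ∀ f ∈ s, SuperGL.map (A.toLoc f) g ∈ localGroup 𝕂 n (A.loc f)) :
    g ∈ localGroup 𝕂 n A := (groupFunctor 𝕂 k n).mem_sheafify_of_toLoc hs h

theorem map_mem_autGroup (φ : A ⟶ B) {g : SuperGL 𝕂 n A} (hg : g ∈ autGroup 𝕂 n A) :
    SuperGL.map φ g ∈ autGroup 𝕂 n B := (autFunctor 𝕂 k n).map φ g hg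

variable [CharZero 𝕂]

theorem eq_of_mapAdd_toLoc {s : Set A.even} (hs : Ideal.span s = ⊤) {x y : V 𝕂 n A}
    (h : ∀ f ∈ s, mapAdd 𝕂 n (A.toLoc f) x = mapAdd 𝕂 n (A.toLoc f) y) : x = y := by
  refine ext_coord fun a => sub_eq_zero.1 (eq_zero_of_toLoc hs fun f hf => ?_)
  rw [map_sub, ← coord_mapAdd, ← coord_mapAdd, h f hf, sub_self]

/-- Preservation of the unit and of products are equations in V_A. They hold over every A_f of some
covering, and elements of V_A are separated by such a covering, coordinate by coordinate. -/
theorem localGroup_le_autGroup (A : CommSuperAlg.{u, v} k) :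
    localGroup 𝕂 n A ≤ autGroup 𝕂 n A := by
  intro g hg
  obtain ⟨s, hs, h⟩ := (groupFunctor 𝕂 k n).mem_sheafify_iff.1 hg
  have h' : ∀ f ∈ s, SuperGL.map (A.toLoc f) g ∈ autGroup 𝕂 n (A.loc f) := fun f hf =>
    elemGroup_le_autGroup _ (h f hf)
  have h1 : ∀ {B : CommSuperAlg.{u, v} k} (φ : A ⟶ B), mapAdd 𝕂 n φ 1 = 1 := fun φ => by
    rw [one_eq, mapAdd_tmul, map_one, one_eq]
  refine ⟨eq_of_mapAdd_toLoc hs fun f hf => ?_, fun x y => eq_of_mapAdd_toLoc hs fun f hf => ?_⟩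
  · rw [← SuperGL.map_mapAdd, h1, (h' f hf).1]
  · rw [← SuperGL.map_mapAdd, mapAdd_mul, mapAdd_mul, (h' f hf).2, SuperGL.map_mapAdd,
      SuperGL.map_mapAdd]

/-! ### Reduction of an automorphism by elementary ones -/

/-- Multiplication on the right applies g after the elementary substitution, so the image of ξ_i
changes by a multiple of g(ξ^a), an elementary row operation on the images of the generators. -/
theorem exists_mul_root {g : SuperGL 𝕂 n A} {a : Finset (Fin n)} {i : Fin n} (h : a ≠ {i}) {t : A}
    (ht : t ∈ A.grading ((a.card : ZMod 2) + 1)) : ∃ x ∈ elemGroup 𝕂 n A,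
      ∀ j, (g * x).1 (vmon 𝕂 A {j}) =
        g.1 (vmon 𝕂 A {j}) + if j = i then t • g.1 (vmon 𝕂 A a) else 0 := by
  obtain ⟨x, hx, e⟩ := exists_mem_elemGroup_root (𝕂 := 𝕂) h ht
  refine ⟨x, hx, fun j => ?_⟩
  show g.1 (x.1 _) = _
  rw [e, map_add]
  split_ifs
  · rw [map_smul]
  · rw [map_zero]

/-- This is the parity of ξ^a ∂_i, so the coefficient to be removed can always serve as the
parameter of that root vector. -/
theorem coord_map_mem (g : SuperGL 𝕂 n A) (i : Fin n) (a : Finset (Fin n)) :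
    coord a (g.1 (vmon 𝕂 A {i})) ∈ A.grading ((a.card : ZMod 2) + 1) := by
  refine coord_mem ((g.2 1 _).2 ?_) a
  simpa using vmon_mem (𝕂 := 𝕂) (A := A) {i}

theorem eq_one_of_vmon_singleton {g : SuperGL 𝕂 n A} (hg : g ∈ autGroup 𝕂 n A)
    (h : ∀ i, g.1 (vmon 𝕂 A {i}) = vmon 𝕂 A {i}) : g = 1 :=
  Subtype.ext (LinearEquiv.toLinearMap_injective
    (eq_id_of_vmon_singleton (g := g.1.toLinearMap) hg.1 hg.2 h))

theorem filt_eq_zero {d : ℕ} (hd : n < d) {x : V 𝕂 n A} (hx : x ∈ filt 𝕂 n A d) : x = 0 :=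
  ext_coord fun a => by
    rw [map_zero]
    exact hx a ((card_finset_fin_le a).trans_lt hd)

/-- The root vector ∂_i has a = ∅ and g(1) = 1, so the correction adds a bare scalar to g(ξ_i). Its
parameter is minus the constant term, and the indices are treated one after another without
interference. -/
theorem exists_kill_constant {g : SuperGL 𝕂 n A} (hg : g ∈ autGroup 𝕂 n A) :
    ∃ x ∈ elemGroup 𝕂 n A, ∀ i, (g * x).1 (vmon 𝕂 A {i}) ∈ filt 𝕂 n A 1 := by
  have key : ∀ T : Finset (Fin n), ∃ x ∈ elemGroup 𝕂 n A, ∀ i ∈ T,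
      coord ∅ ((g * x).1 (vmon 𝕂 A {i})) = 0 := by
    intro T
    induction T using Finset.induction_on with
    | empty => exact ⟨1, one_mem _, by simp⟩
    | insert i T hi ih =>
      obtain ⟨x, hx, h⟩ := ih
      have hgx := mul_mem hg (elemGroup_le_autGroup A hx)
      obtain ⟨y, hy, e⟩ := exists_mul_root (g := g * x) (Finset.singleton_ne_empty i).symm
        (neg_mem (coord_map_mem (g * x) i ∅))
      refine ⟨x * y, mul_mem hx hy, fun j hj => ?_⟩
      rw [← mul_assoc, e, map_add, vmon_empty, hgx.1]
      split_ifs with hji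
      · rw [hji, map_smul, ← vmon_empty (A := A), coord_vmon, if_pos rfl, smul_eq_mul, mul_one,
          add_neg_cancel]
      · rw [map_zero, add_zero]
        exact h j (Finset.mem_of_mem_insert_of_ne hj hji)
  obtain ⟨x, hx, h⟩ := key Finset.univ
  refine ⟨x, hx, fun i a ha => ?_⟩
  rw [Finset.card_eq_zero.1 (Nat.lt_one_iff.1 ha)]
  exact h i (Finset.mem_univ i)

/-- For |a| = d ≥ 2 one has g(ξ^a) = ξ^a + (degree > d). Adding t g(ξ^a) to g(ξ_i) therefore alters
a single coefficient in degree d and nothing below, so the pairs (a, i) can be dealt with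
independently. -/
theorem exists_kill_degree {g : SuperGL 𝕂 n A} (hg : g ∈ autGroup 𝕂 n A) {d : ℕ} (hd : 2 ≤ d)
    (h : ∀ i, g.1 (vmon 𝕂 A {i}) - vmon 𝕂 A {i} ∈ filt 𝕂 n A d) : ∃ x ∈ elemGroup 𝕂 n A,
      ∀ i, (g * x).1 (vmon 𝕂 A {i}) - vmon 𝕂 A {i} ∈ filt 𝕂 n A (d + 1) := by
  have key : ∀ T : Finset (Finset (Fin n) × Fin n), ∃ x ∈ elemGroup 𝕂 n A,
      (∀ i, (g * x).1 (vmon 𝕂 A {i}) - vmon 𝕂 A {i} ∈ filt 𝕂 n A d) ∧ ∀ p ∈ T, p.1.card = d →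
        coord p.1 ((g * x).1 (vmon 𝕂 A {p.2}) - vmon 𝕂 A {p.2}) = 0 := by
    intro T
    induction T using Finset.induction_on with
    | empty => exact ⟨1, one_mem _, by simpa using h, by simp⟩
    | insert p T hp ih =>
      obtain ⟨a, i⟩ := p
      obtain ⟨x, hx, h1, h2⟩ := ih
      by_cases had : a.card = d
      swap
      · refine ⟨x, hx, h1, fun p hp hpd => ?_⟩
        rcases Finset.mem_insert.1 hp with rfl | hp
        · exact absurd hpd had
        · exact h2 p hp hpd
      have hgx := mul_mem hg (elemGroup_le_autGroup A hx)
      -- Because d ≥ 2, the operator ξ^a ∂_i is a root vector and not toral.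
      have hai : a ≠ {i} := by rintro rfl; rw [Finset.card_singleton] at had; omega
      have hsub := map_vmon_sub_mem_filt (g := (g * x).1.toLinearMap) hgx.1 hgx.2
        (fun i => filt_anti hd (h1 i)) a
      rw [had] at hsub
      set c := (g * x).1 (vmon 𝕂 A a) - vmon 𝕂 A a with hc
      replace hsub : c ∈ filt 𝕂 n A (d + 1) := hsub
      have hca : (g * x).1 (vmon 𝕂 A a) = vmon 𝕂 A a + c := by rw [hc]; abel
      -- The parameter is minus the coefficient of ξ^a in the current image of ξ_i; since a ≠ {i},
      -- subtracting ξ_i does not affect that coefficient.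
      obtain ⟨y, hy, e⟩ := exists_mul_root (g := g * x) hai
        (neg_mem (coord_map_mem (g * x) i a))
      refine ⟨x * y, mul_mem hx hy, fun j => ?_, fun p hp hpd => ?_⟩
      · rw [← mul_assoc, e, add_sub_right_comm]
        refine add_mem (h1 j) ?_
        split_ifs
        · rw [hca]
          exact Submodule.smul_mem _ _ (add_mem (vmon_mem_filt had.ge)
            (filt_anti (Nat.le_succ d) hsub))
        · exact zero_mem _
      · obtain ⟨b, j⟩ := p
        dsimp only at hpd ⊢
        rw [← mul_assoc, e, add_sub_right_comm, map_add]
        by_cases hji : j = i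
        · subst hji
          rw [if_pos rfl, hca, map_smul, map_add, hsub b (by omega), add_zero, coord_vmon]
          by_cases hab : a = b
          · subst hab
            rw [if_pos rfl, map_sub, coord_vmon, if_neg (Ne.symm hai)]
            simp
          · rw [if_neg hab, smul_zero, add_zero]
            refine h2 (b, j) (Finset.mem_of_mem_insert_of_ne hp ?_) hpd
            rintro ⟨⟩; exact hab rfl
        · rw [if_neg hji, map_zero, add_zero]
          refine h2 (b, j) (Finset.mem_of_mem_insert_of_ne hp ?_) hpd
          rintro ⟨⟩; exact hji rfl
  obtain ⟨x, hx, h1, h2⟩ := key Finset.univ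
  refine ⟨x, hx, fun i a ha => ?_⟩
  rcases Nat.lt_succ_iff_lt_or_eq.1 ha with ha | ha
  · exact h1 i a ha
  · exact h2 (a, i) (Finset.mem_univ _) ha

/-- Descending induction on the degree still to be cleared, measured by e. When d > n the filtration
step is zero, so g fixes all generators and is the identity. -/
theorem mem_elemGroup_of_sub_mem_filt (e : ℕ) {d : ℕ} (hd : 2 ≤ d) (hde : n < d + e)
    {g : SuperGL 𝕂 n A} (hg : g ∈ autGroup 𝕂 n A)
    (h : ∀ i, g.1 (vmon 𝕂 A {i}) - vmon 𝕂 A {i} ∈ filt 𝕂 n A d) : g ∈ elemGroup 𝕂 n A := by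
  induction e generalizing d g with
  | zero =>
    rw [eq_one_of_vmon_singleton hg fun i => sub_eq_zero.1 (filt_eq_zero hde (h i))]
    exact one_mem _
  | succ e ih =>
    obtain ⟨x, hx, h'⟩ := exists_kill_degree hg hd h
    have := ih (d := d + 1) (by omega) (by omega) (mul_mem hg (elemGroup_le_autGroup A hx)) h'
    exact (Subgroup.mul_mem_cancel_right _ hx).1 this

/-! ### Gaussian elimination on the linear part, over localizations -/

/-- The linear part of an endomorphism of `V_A`. -/
def linPart (g : SuperGL 𝕂 n A) (i j : Fin n) : A := coord {j} (g.1 (vmon 𝕂 A {i}))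

theorem linPart_mem (g : SuperGL 𝕂 n A) (i j : Fin n) : linPart g i j ∈ A.grading 0 := by
  have := coord_map_mem g i {j}
  rwa [Finset.card_singleton, Nat.cast_one, CharTwo.add_self_eq_zero] at this

/-- `g` preserves the augmentation ideal, and the first `c` columns of its linear part are those
of the identity matrix. -/
structure IsReduced (g : SuperGL 𝕂 n A) (c : ℕ) : Prop where
  mem_aut : g ∈ autGroup 𝕂 n A
  mem_filt : ∀ i, g.1 (vmon 𝕂 A {i}) ∈ filt 𝕂 n A 1
  col : ∀ i j : Fin n, j.val < c → linPart g i j = if i = j then 1 else 0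

/-- The linear part of g(y) is the linear part of y times the matrix of g: the constant term of y
goes to a constant because g(1) = 1, and terms of degree at least 2 stay there because g preserves
the filtration. -/
theorem coord_singleton_map {g : SuperGL 𝕂 n A} (hg : g ∈ autGroup 𝕂 n A)
    (h : ∀ i, g.1 (vmon 𝕂 A {i}) ∈ filt 𝕂 n A 1) (y : V 𝕂 n A) (j : Fin n) :
    coord {j} (g.1 y) = ∑ i, coord {i} y * linPart g i j := by
  have hy : y - coord ∅ y • (1 : V 𝕂 n A) - ∑ i, coord {i} y • vmon 𝕂 A {i} ∈ filt 𝕂 n A 2 := by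
    intro a ha
    rw [map_sub, map_sub, map_smul, map_sum, ← vmon_empty, coord_vmon]
    simp only [map_smul, coord_vmon]
    rcases Nat.le_one_iff_eq_zero_or_eq_one.1 (Nat.lt_succ_iff.1 ha) with ha | ha
    · rw [Finset.card_eq_zero.1 ha]
      simp
    · obtain ⟨l, rfl⟩ := Finset.card_eq_one.1 ha
      rw [Finset.sum_eq_single l (fun i _ hi => by
        rw [if_neg (by simpa using hi), smul_zero]) (by simp)]
      simp
  have h2 := map_mem_filt (g := g.1.toLinearMap) hg.1 hg.2 h hy {j} (by simp)
  have h1 : g.1 1 = 1 := hg.1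
  rw [LinearEquiv.coe_coe, map_sub g.1, map_sub g.1, map_smul g.1, h1, map_sum, map_sub, map_sub,
    map_smul, ← vmon_empty, coord_vmon, if_neg (Finset.singleton_ne_empty j).symm, smul_zero, sub_zero,
    map_sum, sub_eq_zero] at h2
  rw [h2]
  simp only [map_smul]
  rfl

/-- With y the preimage of ξ_c under g, the coefficients y_i satisfy Σ y_i L_ij = δ_cj. For j < c
column j is already standard, so y_j = 0; then j = c expresses 1 as a combination of the entries
L_ic with i ≥ c. No assumption on the constant term of y is needed. -/
theorem IsReduced.span_col {g : SuperGL 𝕂 n A} {c : Fin n} (h : IsReduced g c) :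
    Ideal.span {f : A.even | ∃ i, c ≤ i ∧ (f : A) = linPart g i c} = ⊤ := by
  set y := (g⁻¹).1 (vmon 𝕂 A {c}) with hy
  have hgy : g.1 y = vmon 𝕂 A {c} := g.1.apply_symm_apply _
  have hymem : ∀ i, coord {i} y ∈ A.grading 0 := fun i => linPart_mem g⁻¹ c i
  have h1 : ∀ j, (if c = j then 1 else 0) = ∑ i, coord {i} y * linPart g i j := fun j => by
    rw [← coord_singleton_map h.mem_aut h.mem_filt, hgy, coord_vmon]
    simp
  have h2 : ∀ i, i < c → coord {i} y = 0 := by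
    intro i hi
    have := h1 i
    rw [if_neg hi.ne', Finset.sum_eq_single i (fun l _ hl => by
      rw [h.col l i hi, if_neg hl, mul_zero]) (by simp), h.col i i hi, if_pos rfl, mul_one] at this
    exact this.symm
  rw [Ideal.eq_top_iff_one]
  have h3 : (1 : A.even) = ∑ i, (⟨coord {i} y, hymem i⟩ : A.even) * ⟨linPart g i c, linPart_mem g i c⟩ := by
    refine Subtype.ext ?_
    have := h1 c
    rw [if_pos rfl] at this
    refine this.trans ?_
    rw [AddSubmonoidClass.coe_finsetSum]
    rfl
  rw [h3]
  refine sum_mem fun i _ => ?_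
  by_cases hi : i < c
  · have : (⟨coord {i} y, hymem i⟩ : A.even) = 0 := Subtype.ext (h2 i hi)
    rw [this, zero_mul]
    exact zero_mem _
  · exact Ideal.mul_mem_left _ _ (Ideal.subset_span ⟨i, not_lt.1 hi, rfl⟩)

theorem IsReduced.map (φ : A ⟶ B) {g : SuperGL 𝕂 n A} {c : ℕ} (h : IsReduced g c) :
    IsReduced (SuperGL.map φ g) c ∧
      ∀ i j, linPart (SuperGL.map φ g) i j = homAlg φ (linPart g i j) := by
  have e : ∀ i, (SuperGL.map φ g).1 (vmon 𝕂 B {i}) = mapAdd 𝕂 n φ (g.1 (vmon 𝕂 A {i})) := fun i => by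
    rw [← mapAdd_vmon φ, SuperGL.map_mapAdd]
  have e' : ∀ i j, linPart (SuperGL.map φ g) i j = homAlg φ (linPart g i j) := fun i j => by
    rw [linPart, e, coord_mapAdd, linPart]
  refine ⟨⟨map_mem_autGroup φ h.mem_aut, fun i a ha => ?_, fun i j hj => ?_⟩, e'⟩
  · rw [e, coord_mapAdd, h.mem_filt i a ha, map_zero]
  · rw [e', h.col i j hj]
    split_ifs <;> simp

/-- The elementary row operation adding `t` times row `j` to row `i`. -/
theorem IsReduced.exists_add_row {g : SuperGL 𝕂 n A} {c : ℕ} (h : IsReduced g c) {i j : Fin n}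
    (hij : i ≠ j) (hj : c ≤ j) {t : A} (ht : t ∈ A.grading 0) :
    ∃ x ∈ elemGroup 𝕂 n A, IsReduced (g * x) c ∧ ∀ l m,
      linPart (g * x) l m = linPart g l m + if l = i then t * linPart g j m else 0 := by
  obtain ⟨x, hx, e⟩ := exists_mul_root (g := g) (a := {j}) (i := i) (t := t)
    (by simpa using Ne.symm hij)
    (by rwa [Finset.card_singleton, Nat.cast_one, CharTwo.add_self_eq_zero])
  have e' : ∀ l m, linPart (g * x) l m = linPart g l m +
      if l = i then t * linPart g j m else 0 := fun l m => by
    rw [linPart, e, map_add]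
    split_ifs
    · rw [map_smul]; rfl
    · rw [map_zero]; rfl
  refine ⟨x, hx, ⟨mul_mem h.mem_aut (elemGroup_le_autGroup A hx), fun l => ?_, fun l m hm => ?_⟩, e'⟩
  · rw [e]
    refine add_mem (h.mem_filt l) ?_
    split_ifs
    · exact Submodule.smul_mem _ _ (h.mem_filt j)
    · exact zero_mem _
  · have hjm : j ≠ m := by rintro rfl; omega
    rw [e', h.col j m hm, if_neg hjm, mul_zero, ite_self, add_zero, h.col l m hm]

/-- The row operation multiplying row `i` by a unit. -/
theorem IsReduced.exists_scale_row {g : SuperGL 𝕂 n A} {c : ℕ} (h : IsReduced g c) {i : Fin n}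
    (hi : c ≤ i) (t : A.evenˣ) : ∃ x ∈ elemGroup 𝕂 n A, IsReduced (g * x) c ∧ ∀ l m,
      linPart (g * x) l m = if l = i then (t : A) * linPart g l m else linPart g l m := by
  obtain ⟨x, hx, e⟩ := exists_mem_elemGroup_scale (𝕂 := 𝕂) i t
  have e1 : ∀ l, (g * x).1 (vmon 𝕂 A {l}) =
      if l = i then (t : A) • g.1 (vmon 𝕂 A {l}) else g.1 (vmon 𝕂 A {l}) := fun l => by
    show g.1 (x.1 _) = _
    rw [e]
    split_ifs
    · rw [map_smul]
    · rfl
  have e' : ∀ l m, linPart (g * x) l m =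
      if l = i then (t : A) * linPart g l m else linPart g l m := fun l m => by
    rw [linPart, e1]
    split_ifs
    · rw [map_smul]; rfl
    · rfl
  refine ⟨x, hx, ⟨mul_mem h.mem_aut (elemGroup_le_autGroup A hx), fun l => ?_, fun l m hm => ?_⟩, e'⟩
  · rw [e1]
    split_ifs
    · exact Submodule.smul_mem _ _ (h.mem_filt l)
    · exact h.mem_filt l
  · rw [e', h.col l m hm]
    have him : i ≠ m := by rintro rfl; omega
    by_cases hl : l = i
    · subst hl; rw [if_pos rfl, if_neg him, mul_zero]
    · rw [if_neg hl]

/-- If the unit sits on the diagonal, the torus rescales it to 1. Otherwise adding (1 - L_cc) t⁻¹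
times row i to row c makes the diagonal entry 1, with no row exchange. -/
theorem IsReduced.exists_pivot {g : SuperGL 𝕂 n A} {c : Fin n} (h : IsReduced g c) {i : Fin n}
    (hi : c ≤ i) (t : A.evenˣ) (ht : (t : A) = linPart g i c) :
    ∃ x ∈ elemGroup 𝕂 n A, IsReduced (g * x) c ∧ linPart (g * x) c c = 1 := by
  have hinv : ((t⁻¹ : A.evenˣ) : A) * (t : A) = 1 :=
    congrArg Subtype.val (Units.inv_mul t)
  by_cases hic : i = c
  · subst hic
    obtain ⟨x, hx, hr, e⟩ := h.exists_scale_row hi t⁻¹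
    exact ⟨x, hx, hr, by rw [e, if_pos rfl, ← ht, hinv]⟩
  · obtain ⟨x, hx, hr, e⟩ := h.exists_add_row (Ne.symm hic) hi
      (t := (1 - linPart g c c) * ((t⁻¹ : A.evenˣ) : A)) (by
        simpa using SetLike.mul_mem_graded
          (sub_mem (SetLike.one_mem_graded A.grading) (linPart_mem g c c))
          ((t⁻¹ : A.evenˣ) : A.even).2)
    exact ⟨x, hx, hr, by rw [e, if_pos rfl, ← ht, mul_assoc, hinv, mul_one]; abel⟩

/-- Multiples of row c, which carries the pivot 1, are subtracted from every other row, above and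
below. Row c itself never changes, and it is zero in the earlier columns, so these stay standard. -/
theorem IsReduced.exists_clear {g : SuperGL 𝕂 n A} {c : Fin n} (h : IsReduced g c)
    (h1 : linPart g c c = 1) : ∃ x ∈ elemGroup 𝕂 n A, IsReduced (g * x) (c + 1) := by
  have key : ∀ T : Finset (Fin n), c ∉ T → ∃ x ∈ elemGroup 𝕂 n A, IsReduced (g * x) c ∧
      linPart (g * x) c c = 1 ∧ ∀ i ∈ T, linPart (g * x) i c = 0 := by
    intro T
    induction T using Finset.induction_on with
    | empty => exact fun _ => ⟨1, one_mem _, by simpa using h, by simpa using h1, by simp⟩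
    | insert i T hi ih =>
      intro hc
      rw [Finset.mem_insert, not_or] at hc
      obtain ⟨x, hx, hr, h2, h3⟩ := ih hc.2
      obtain ⟨y, hy, hr', e⟩ := hr.exists_add_row (Ne.symm hc.1) le_rfl
        (neg_mem (linPart_mem (g * x) i c))
      rw [mul_assoc] at hr' e
      refine ⟨x * y, mul_mem hx hy, hr', by rw [e, if_neg hc.1, add_zero, h2], fun j hj => ?_⟩
      rw [e, h2, mul_one]
      split_ifs with hji
      · rw [hji, add_neg_cancel]
      · rw [add_zero, h3 j (Finset.mem_of_mem_insert_of_ne hj hji)]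
  obtain ⟨x, hx, hr, h2, h3⟩ := key (Finset.univ.erase c) (Finset.notMem_erase _ _)
  refine ⟨x, hx, hr.mem_aut, hr.mem_filt, fun i j hj => ?_⟩
  rcases Nat.lt_succ_iff_lt_or_eq.1 hj with hj | hj
  · exact hr.col i j hj
  · rw [Fin.ext hj]
    split_ifs with hic
    · rw [hic, h2]
    · exact h3 i (Finset.mem_erase.2 ⟨hic, Finset.mem_univ i⟩)

/-- When all columns are standard, g is the identity on generators modulo degree 2, and the removal
of higher degrees applies from d = 2. No localization occurs here. -/
theorem IsReduced.mem_elemGroup {g : SuperGL 𝕂 n A} {c : ℕ} (hc : n ≤ c) (h : IsReduced g c) :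
    g ∈ elemGroup 𝕂 n A := by
  refine mem_elemGroup_of_sub_mem_filt n le_rfl (by omega) h.mem_aut fun i a ha => ?_
  rw [map_sub, coord_vmon]
  rcases Nat.le_one_iff_eq_zero_or_eq_one.1 (Nat.lt_succ_iff.1 ha) with ha | ha
  · rw [h.mem_filt i a (by omega), Finset.card_eq_zero.1 ha]
    simp
  · obtain ⟨l, rfl⟩ := Finset.card_eq_one.1 ha
    have := h.col i l (by omega)
    rw [linPart] at this
    rw [this]
    simp

/-- The unit of `(A_f)₀` given by `f`. -/
theorem exists_unit_toLoc (f : A.even) : ∃ t : (A.loc f).evenˣ, (t : A.loc f) = homAlg (A.toLoc f) f := by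
  have h : (Loc.mk (f : A) 0 * Loc.mk (1 : A) 1 : Loc A f) = 1 := by
    rw [Loc.mk_mul, Loc.one_eq]
    exact Loc.mk_eq.2 ⟨0, by simp⟩
  let p : (A.loc f).even := ⟨(Loc.mk (f : A) 0 : Loc A f), ⟨f, f.2, 0, rfl⟩⟩
  let q : (A.loc f).even := ⟨(Loc.mk (1 : A) 1 : Loc A f), ⟨1, SetLike.one_mem_graded _, 1, rfl⟩⟩
  have hpq : p * q = 1 := Subtype.ext h
  exact ⟨⟨p, q, hpq, by rw [mul_comm, hpq]⟩, rfl⟩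

/-- Induction on the number e of columns left. The ring A varies in the induction, because each
column is cleared only after inverting one of its entries. -/
theorem IsReduced.mem_localGroup (e : ℕ) {c : ℕ} (hc : n ≤ c + e) {g : SuperGL 𝕂 n A}
    (h : IsReduced g c) : g ∈ localGroup 𝕂 n A := by
  induction e generalizing c A with
  | zero => exact elemGroup_le_localGroup A (h.mem_elemGroup hc)
  | succ e ih =>
    by_cases hcn : n ≤ c
    · exact elemGroup_le_localGroup A (h.mem_elemGroup hcn)
    obtain ⟨c, rfl⟩ : ∃ c' : Fin n, c'.val = c := ⟨⟨c, not_le.1 hcn⟩, rfl⟩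
    -- The candidate pivots of column c generate the unit ideal, so inverting each in turn is a
    -- Zariski covering of A.
    refine mem_localGroup_of_toLoc h.span_col ?_
    rintro f ⟨i, hi, hf⟩
    obtain ⟨h1, h2⟩ := h.map (A.toLoc f)
    obtain ⟨t, ht⟩ := exists_unit_toLoc f
    obtain ⟨x, hx, hr, hp⟩ := h1.exists_pivot hi t (by rw [ht, h2, hf])
    obtain ⟨y, hy, hr'⟩ := hr.exists_clear hp
    have h3 := ih (by omega) hr'
    have h4 := elemGroup_le_localGroup _ hx
    have h5 := elemGroup_le_localGroup _ hy
    exact (Subgroup.mul_mem_cancel_right _ h4).1 ((Subgroup.mul_mem_cancel_right _ h5).1 h3)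

theorem autGroup_le_localGroup (A : CommSuperAlg.{u, v} k) :
    autGroup 𝕂 n A ≤ localGroup 𝕂 n A := by
  intro g hg
  obtain ⟨x, hx, h⟩ := exists_kill_constant hg
  have hr : IsReduced (g * x) 0 :=
    ⟨mul_mem hg (elemGroup_le_autGroup A hx), h, fun i j hj => absurd hj (Nat.not_lt_zero _)⟩
  exact (Subgroup.mul_mem_cancel_right _ (elemGroup_le_localGroup A hx)).1
    (hr.mem_localGroup n (by omega))

end V
end CommSuperAlg

end

/-- For every field `𝕂`, algebraically closed of characteristic zero, every commutative ring `k` and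
every `n ≥ 2`, the supergroup `𝐆_{Λ(n)}` attached to `W(n)` and its defining representation `Λ(n)`
coincides, as a subgroup functor of `GL(V_•)` on commutative `k`-superalgebras, with
`Aut(Λ(n))`. -/
theorem mainTheorem9 (𝕂 : Type w) [Field 𝕂] [IsAlgClosed 𝕂] [CharZero 𝕂]
    (k : Type u) [CommRing k] (n : ℕ) (hn : 2 ≤ n) :
    CommSuperAlg.V.supergroup.{u, v, w} 𝕂 k n = CommSuperAlg.V.autFunctor.{u, v, w} 𝕂 k n :=
  SubgroupFunctor.ext (funext fun A => le_antisymm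
    (CommSuperAlg.V.localGroup_le_autGroup A) (CommSuperAlg.V.autGroup_le_localGroup A))
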